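/- Consider the Cauchy problem for the nonlinear Dirac system on $\mathbb R$ $$i(u_t+u_x)=-mv+N_1(u,v),\qquad i(v_t-v_x)=-mu+N_2(u,v),\qquad (u,v)|_{t=0}=(u_0,v_0),$$ with $u,v$ complex valued and $m\ge 0$, where $N_1,N_2:\mathbb C^2\to\mathbb C$ satisfy: (A1) there are constants $a_k,b_k,c_k,d_k\in\mathbb C$ $(k=1,2,3)$ such that for all $u,v\in\mathbb C$ $$N_1(u,v)=u\,(a_1|v|^2+a_2v^2+a_3\overline v^2)+\overline u\,(b_1|v|^2+b_2v^2+b_3\overline v^2),$$ $$N_2(u,v)=v\,(c_1|u|^2+c_2u^2+c_3\overline u^2)+\overline v\,(d_1|u|^2+d_2u^2+d_3\overline u^2);$$ (A2) $\Re\big(i\overline u N_1(u,v)+i\overline v N_2(u,v)\big)=0$ for all $u,v\in\mathbb C$. For every $\alpha\in\mathbb R$ this class contains the massive Thirring nonlinearity $(N_1,N_2)=(\alpha u|v|^2,\ \alpha v|u|^2)$ and the massive Gross–Neveu nonlinearity $(N_1,N_2)=\big(2\alpha v(\overline uv+u\overline v),\ 2\alpha u(\overline uv+u\overline v)\big)$.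 For all $N_1,N_2$ satisfying (A1) and (A2) there is a constant $C_0>0$, depending only on $N_1,N_2$, such that for every $m\ge 0$ and all $u_0,v_0\in H^1(\mathbb R;\mathbb C)$ with $$\|u_0\|_{L^2(\mathbb R)}^2+\|v_0\|_{L^2(\mathbb R)}^2\le C_0,$$ the Cauchy problem has a unique global solution $(u,v)\in C([0,\infty);H^1(\mathbb R))\cap C^1([0,\infty);L^2(\mathbb R))$. Here the equations hold in $L^2(\mathbb R)$ for every $t\ge 0$ (with the one-sided time derivative at $t=0$), and uniqueness is among all solutions in this class. -/

import Mathlib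

open MeasureTheory Set
open scoped ContDiff ComplexConjugate

noncomputable section

namespace Dirac

/-- The space `L²(ℝ; ℂ)`. -/
abbrev L2 : Type := Lp ℂ 2 (volume : Measure ℝ)

/-- `g` is the weak derivative of `f`: `∫ f φ' = -∫ g φ` for all test functions `φ ∈ C_c^∞(ℝ; ℂ)`. -/
def IsWeakDeriv (f g : L2) : Prop :=
  ∀ φ : ℝ → ℂ, ContDiff ℝ ∞ φ → HasCompactSupport φ →
    ∫ x, f x * deriv φ x = -∫ x, g x * φ x

theorem integrable_mul_of_continuous (f : L2) {φ : ℝ → ℂ} (hφ : Continuous φ)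
    (hc : HasCompactSupport φ) : Integrable (fun x => f x * φ x) :=
  (Lp.memLp f).integrable_mul (hφ.memLp_of_hasCompactSupport (p := 2) hc)

theorem integral_add_mul (f₁ f₂ : L2) {φ : ℝ → ℂ} (hφ : Continuous φ)
    (hc : HasCompactSupport φ) :
    ∫ x, (f₁ + f₂ : L2) x * φ x = (∫ x, f₁ x * φ x) + ∫ x, f₂ x * φ x := by
  rw [← integral_add (integrable_mul_of_continuous f₁ hφ hc)
    (integrable_mul_of_continuous f₂ hφ hc)]
  refine integral_congr_ae ?_
  filter_upwards [Lp.coeFn_add f₁ f₂] with x hx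
  rw [hx, Pi.add_apply, add_mul]

theorem integral_smul_mul (c : ℂ) (f : L2) (φ : ℝ → ℂ) :
    ∫ x, (c • f : L2) x * φ x = c * ∫ x, f x * φ x := by
  rw [← integral_const_mul]
  refine integral_congr_ae ?_
  filter_upwards [Lp.coeFn_smul c f] with x hx
  rw [hx, Pi.smul_apply, smul_eq_mul, mul_assoc]

/-- The Sobolev space `H¹(ℝ; ℂ)`, realised as the space of pairs `(f, f')` with `f, f' ∈ L²` and
`f'` the weak derivative of `f`; the inherited norm is `(‖f‖² + ‖f'‖²)^{1/2}`. -/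
def H1 : Submodule ℂ (WithLp 2 (L2 × L2)) where
  carrier := {p | IsWeakDeriv p.fst p.snd}
  zero_mem' := by
    intro φ _ _
    have h := fun ψ : ℝ → ℂ => integral_smul_mul 0 (0 : L2) ψ
    simp only [zero_smul, zero_mul] at h
    simp only [WithLp.zero_fst, WithLp.zero_snd, h, neg_zero]
  add_mem' := by
    intro p q hp hq φ hφ hc
    have h₁ := hp φ hφ hc
    have h₂ := hq φ hφ hc
    rw [WithLp.add_fst, WithLp.add_snd,
      integral_add_mul _ _ (hφ.continuous_deriv (by simp)) hc.deriv,
      integral_add_mul _ _ hφ.continuous hc, h₁, h₂, neg_add]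
  smul_mem' := by
    intro c p hp φ hφ hc
    have h := hp φ hφ hc
    rw [WithLp.smul_fst, WithLp.smul_snd, integral_smul_mul, integral_smul_mul, h, mul_neg]

/-- The inclusion `H¹ → L²`. -/
def toL2 (f : H1) : L2 := f.1.fst

/-- The weak derivative `∂ₓ : H¹ → L²`. -/
def dx (f : H1) : L2 := f.1.snd

/-- `F(p, q)` is a linear combination of the products of one of `p, p̄` with one of
`|q|², q², q̄²`. -/
def IsCubic (F : ℂ → ℂ → ℂ) : Prop :=
  ∃ a b : Fin 3 → ℂ, ∀ p q : ℂ,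
    F p q = p * (a 0 * (‖q‖ : ℂ) ^ 2 + a 1 * q ^ 2 + a 2 * conj q ^ 2)
      + conj p * (b 0 * (‖q‖ : ℂ) ^ 2 + b 1 * q ^ 2 + b 2 * conj q ^ 2)

/-- Products of a linear and a quadratic factor are of the form above. -/
theorem isCubic_product (α₁ α₂ α₃ α₄ α₅ : ℂ) :
    IsCubic fun p q => (α₁ * p + α₂ * conj p) *
      (α₃ * (‖q‖ : ℂ) ^ 2 + α₄ * q ^ 2 + α₅ * conj q ^ 2) :=
  ⟨![α₁ * α₃, α₁ * α₄, α₁ * α₅], ![α₂ * α₃, α₂ * α₄, α₂ * α₅], fun p q => by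
    simp only [Matrix.cons_val]
    ring⟩

/-- The assumptions on the nonlinearity: the cubic structure of `N₁` (linear in `u`, quadratic in
`v`) and of `N₂` (linear in `v`, quadratic in `u`), and the conservation-of-charge identity. -/
structure IsAdmissible (N₁ N₂ : ℂ → ℂ → ℂ) : Prop where
  cubic₁ : IsCubic N₁
  cubic₂ : IsCubic fun v u => N₂ u v
  charge : ∀ u v : ℂ,
    (Complex.I * conj u * N₁ u v + Complex.I * conj v * N₂ u v).re = 0

/-- `(u, v) ∈ C([0,∞); H¹) ∩ C¹([0,∞); L²)` solves
`i(u_t + u_x) = -m v + N₁(u, v)`, `i(v_t - v_x) = -m u + N₂(u, v)` on `[0,∞) × ℝ`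
with `(u, v)|_{t=0} = (u₀, v₀)`. Only the values of `u`, `v` at times `t ≥ 0` matter; the time
derivative is the one in `L²`, one-sided at `t = 0`. -/
structure IsGlobalSolution (m : ℝ) (N₁ N₂ : ℂ → ℂ → ℂ) (u₀ v₀ : H1) (u v : ℝ → H1) : Prop where
  continuousOn_u : ContinuousOn u (Ici 0)
  continuousOn_v : ContinuousOn v (Ici 0)
  contDiffOn_u : ContDiffOn ℝ 1 (fun t => toL2 (u t)) (Ici 0)
  contDiffOn_v : ContDiffOn ℝ 1 (fun t => toL2 (v t)) (Ici 0)
  eq_u : ∀ t ∈ Ici (0 : ℝ), ∀ᵐ x : ℝ,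
    Complex.I * (derivWithin (fun s => toL2 (u s)) (Ici 0) t x + dx (u t) x)
      = -(m : ℂ) * toL2 (v t) x + N₁ (toL2 (u t) x) (toL2 (v t) x)
  eq_v : ∀ t ∈ Ici (0 : ℝ), ∀ᵐ x : ℝ,
    Complex.I * (derivWithin (fun s => toL2 (v s)) (Ici 0) t x - dx (v t) x)
      = -(m : ℂ) * toL2 (u t) x + N₂ (toL2 (u t) x) (toL2 (v t) x)
  initial_u : u 0 = u₀
  initial_v : v 0 = v₀

end Dirac

end

open MeasureTheory Set Filter Topology
open scoped ContDiff ComplexConjugate Convolution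

noncomputable section

namespace Dirac

/-! In the coordinates U(t,x) = u(t,x+t), V(t,x) = v(t,x-t) the transport terms disappear and the
system becomes an ordinary differential equation on H¹ × H¹. Its field is locally Lipschitz because
H¹(ℝ) embeds in the bounded continuous functions and is an algebra. So everything rests on an a
priori bound in H¹.

The heart is a supremum bound along characteristics. For fixed y, let E(t) be the charge ∫ |u|² +
|v|² to the right of the line x = y + t. By (A2) the sources cancel pointwise, u does not cross the
line, and v crosses it at relative speed 2, so E' = -2|v(t,y+t)|² (`hasDerivWithinAt_charge_add`).
Hence the integral of |v|² along the characteristic of u is at most E(0)/2, whatever the size of the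
data. By (A1), N₁ is linear in u and quadratic in v, so along that line |u|² obeys a Gronwall
inequality whose coefficient |v|² is integrable (`norm_sq_le_of_charge`). The mirror image, with
charge to the left of x = y - t, bounds v. Once the supremum is controlled, the cubic field grows
linearly in H¹ (`Tame.growth`), and Gronwall again bounds the H¹ norm (`exists_forall_norm_le`).

Continuation to maximal times is avoided by a cutoff. The truncated field is globally Lipschitz, and
along one of its solutions the cutoff is merely a scalar factor θ(t) in [0,1]. The bounds above are
uniform in such factors, so a cutoff radius taken from them is never reached
(`IsLocallyLipschitzField.exists_global`).

Weak derivatives are handled throughout as derivatives of the translation group on L². This yields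
the product rule, the continuous representative `rep` and the change of frame. Uniqueness in the
stated class reduces to uniqueness for the differential equation, since a curve whose L² derivative
is continuous in H¹ is differentiable in H¹ (`hasDerivWithinAt_of_toL2`). -/

/-! ### Translations of `L²` -/

/-- The translation `(shift a f)(x) = f (x + a)` on `L²`. -/
def shift (a : ℝ) : L2 →ₗᵢ[ℂ] L2 :=
  Lp.compMeasurePreservingₗᵢ ℂ (· + a) (measurePreserving_add_right volume a)

theorem coeFn_shift (a : ℝ) (f : L2) : shift a f =ᵐ[volume] fun x => f (x + a) :=
  Lp.coeFn_compMeasurePreserving f (measurePreserving_add_right volume a)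

/-- Almost everywhere statements may be translated. -/
theorem ae_shift {p : ℝ → Prop} (h : ∀ᵐ x, p x) (a : ℝ) : ∀ᵐ x, p (x + a) :=
  (measurePreserving_add_right volume a).quasiMeasurePreserving.ae h

theorem shift_shift (a b : ℝ) (f : L2) : shift a (shift b f) = shift (a + b) f := by
  refine Lp.ext ?_
  filter_upwards [coeFn_shift a (shift b f), coeFn_shift (a + b) f,
    ae_shift (coeFn_shift b f) a] with x h₁ h₂ h₃
  rw [h₁, h₂, h₃, add_assoc]

@[simp]
theorem shift_zero (f : L2) : shift 0 f = f := by
  refine Lp.ext ?_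
  filter_upwards [coeFn_shift 0 f] with x h
  rw [h, add_zero]

theorem continuous_shift : Continuous fun p : ℝ × L2 => shift p.1 p.2 := by
  let g : C(ℝ × L2, C(ℝ, ℝ)) :=
    (ContinuousMap.mk (fun a : ℝ × ℝ => a.2 + a.1) (by fun_prop)).curry.comp ContinuousMap.fst
  exact continuous_snd.compMeasurePreservingLp g.continuous
    (fun p => measurePreserving_add_right volume p.1) (by simp)

theorem continuous_shift_left (f : L2) : Continuous fun a => shift a f :=
  continuous_shift.comp (by fun_prop : Continuous fun a : ℝ => (a, f))

/-! ### Testing against functions -/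

/-- Integration against an `L²` function is a bounded functional on `L²`. -/
theorem exists_clm_integral_mul {φ : ℝ → ℂ} (hφ : MemLp φ 2) :
    ∃ ℓ : L2 →L[ℂ] ℂ, ∀ f : L2, ℓ f = ∫ x, f x * φ x := by
  have hψ : MemLp (fun x => conj (φ x)) 2 := hφ.star
  refine ⟨innerSL ℂ hψ.toLp, fun f => ?_⟩
  rw [innerSL_apply_apply, L2.inner_def]
  refine integral_congr_ae ?_
  filter_upwards [hψ.coeFn_toLp] with x hx
  simp [hx]

theorem memLp_of_contDiff {φ : ℝ → ℂ} (hφ : ContDiff ℝ ∞ φ) (hc : HasCompactSupport φ) :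
    MemLp φ 2 :=
  hφ.continuous.memLp_of_hasCompactSupport hc

theorem locallyIntegrable_coe (f : L2) : LocallyIntegrable f :=
  (Lp.memLp f).locallyIntegrable (by norm_num)

theorem ae_eq_zero_of_forall_integral_mul_eq_zero {f : ℝ → ℂ} (hf : LocallyIntegrable f)
    (h : ∀ φ : ℝ → ℂ, ContDiff ℝ ∞ φ → HasCompactSupport φ → ∫ x, f x * φ x = 0) :
    ∀ᵐ x, f x = 0 := by
  refine ae_eq_zero_of_integral_contDiff_smul_eq_zero hf fun g hg hc => ?_
  rw [← h (fun x => (g x : ℂ)) (Complex.ofRealCLM.contDiff.comp hg)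
    (hc.comp_left (g := fun r : ℝ => (r : ℂ)) Complex.ofReal_zero)]
  refine integral_congr_ae (ae_of_all _ fun x => ?_)
  simp [mul_comm]

theorem ext_of_forall_integral_mul {f g : L2}
    (h : ∀ φ : ℝ → ℂ, ContDiff ℝ ∞ φ → HasCompactSupport φ →
      ∫ x, f x * φ x = ∫ x, g x * φ x) : f = g := by
  rw [← sub_eq_zero]
  refine Lp.ext ?_
  have key : ∀ᵐ x, (f - g : L2) x = 0 := by
    refine ae_eq_zero_of_forall_integral_mul_eq_zero (locallyIntegrable_coe _) fun φ hφ hc => ?_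
    obtain ⟨ℓ, hℓ⟩ := exists_clm_integral_mul (memLp_of_contDiff hφ hc)
    rw [← hℓ, map_sub, hℓ, hℓ, h φ hφ hc, sub_self]
  filter_upwards [key, Lp.coeFn_zero ℂ 2 volume] with x h₁ h₂
  rw [h₁, h₂, Pi.zero_apply]

theorem integral_shift_mul (a : ℝ) (f : L2) (φ : ℝ → ℂ) :
    ∫ x, shift a f x * φ x = ∫ x, f x * φ (x - a) := by
  rw [← integral_add_right_eq_self (fun x => f x * φ (x - a)) a]
  refine integral_congr_ae ?_
  filter_upwards [coeFn_shift a f] with x hx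
  rw [hx, add_sub_cancel_right]

/-- As a function of the shift, the pairing is the convolution of f with the reflected test
function, so the derivative falls on φ. -/
theorem hasDerivAt_integral_shift_mul (f : L2) {φ : ℝ → ℂ} (hφ : ContDiff ℝ ∞ φ)
    (hc : HasCompactSupport φ) (s : ℝ) :
    HasDerivAt (fun a => ∫ x, shift a f x * φ x) (-∫ x, shift s f x * deriv φ x) s := by
  set ψ : ℝ → ℂ := fun x => φ (-x) with hψ
  have hψc : HasCompactSupport ψ := hc.comp_homeomorph (Homeomorph.neg ℝ)
  have hψs : ContDiff ℝ 1 ψ := (hφ.of_le (by simp)).comp contDiff_neg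
  have h := hψc.hasDerivAt_convolution_right (ContinuousLinearMap.mul ℝ ℂ)
    (locallyIntegrable_coe f) hψs s
  have h₁ : (f ⋆[ContinuousLinearMap.mul ℝ ℂ, volume] ψ)
      = fun a => ∫ x, shift a f x * φ x := by
    funext a
    simp only [convolution, ContinuousLinearMap.mul_apply', integral_shift_mul, hψ, neg_sub]
  have h₂ : (f ⋆[ContinuousLinearMap.mul ℝ ℂ, volume] deriv ψ) s
      = -∫ x, shift s f x * deriv φ x := by
    simp only [convolution, ContinuousLinearMap.mul_apply', integral_shift_mul]
    rw [← integral_neg]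
    refine integral_congr_ae (ae_of_all _ fun x => ?_)
    simp only [hψ]
    rw [deriv_comp_neg, neg_sub, mul_neg]
  rwa [h₁, h₂] at h

/-! ### Weak derivatives as derivatives of the translation group -/

theorem IsWeakDeriv.shift {f g : L2} (h : IsWeakDeriv f g) (a : ℝ) :
    IsWeakDeriv (shift a f) (shift a g) := by
  intro φ hφ hc
  rw [integral_shift_mul, integral_shift_mul]
  have := h (fun x => φ (x - a)) (hφ.comp (contDiff_id.sub contDiff_const))
    (hc.comp_homeomorph (Homeomorph.subRight a))
  simpa only [deriv_comp_sub_const] using this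

theorem IsWeakDeriv.hasDerivAt_integral {f g : L2} (h : IsWeakDeriv f g) {φ : ℝ → ℂ}
    (hφ : ContDiff ℝ ∞ φ) (hc : HasCompactSupport φ) (s : ℝ) :
    HasDerivAt (fun a => ∫ x, Dirac.shift a f x * φ x) (∫ x, Dirac.shift s g x * φ x) s := by
  have h₁ := hasDerivAt_integral_shift_mul f hφ hc s
  rwa [h.shift s φ hφ hc, neg_neg] at h₁

/-- Paired with a test function this is the scalar fundamental theorem of calculus; strong
continuity of translations makes the L²-valued integral meaningful. -/
theorem IsWeakDeriv.shift_sub {f g : L2} (h : IsWeakDeriv f g) (a : ℝ) :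
    Dirac.shift a f = f + ∫ s in (0 : ℝ)..a, Dirac.shift s g := by
  refine ext_of_forall_integral_mul fun φ hφ hc => ?_
  obtain ⟨ℓ, hℓ⟩ := exists_clm_integral_mul (memLp_of_contDiff hφ hc)
  have hcont := continuous_shift_left g
  have h₁ : ℓ (∫ s in (0 : ℝ)..a, Dirac.shift s g) = ∫ s in (0 : ℝ)..a, ℓ (Dirac.shift s g) :=
    (ℓ.intervalIntegral_comp_comm (hcont.intervalIntegrable 0 a)).symm
  have h₂ : ∫ s in (0 : ℝ)..a, ℓ (Dirac.shift s g)
      = ℓ (Dirac.shift a f) - ℓ (Dirac.shift 0 f) := by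
    refine intervalIntegral.integral_eq_sub_of_hasDerivAt (f := fun s => ℓ (Dirac.shift s f))
      (fun s _ => ?_) ((ℓ.continuous.comp hcont).intervalIntegrable 0 a)
    simpa only [hℓ] using h.hasDerivAt_integral hφ hc s
  rw [← hℓ, ← hℓ, map_add, h₁, h₂, shift_zero]
  ring

theorem IsWeakDeriv.hasDerivAt {f g : L2} (h : IsWeakDeriv f g) (a : ℝ) :
    HasDerivAt (fun s => Dirac.shift s f) (Dirac.shift a g) a := by
  have hcont := continuous_shift_left g
  have h₁ := (intervalIntegral.integral_hasDerivAt_right (hcont.intervalIntegrable 0 a)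
    (hcont.stronglyMeasurableAtFilter _ _) hcont.continuousAt).const_add f
  refine h₁.congr_of_eventuallyEq (Eventually.of_forall fun s => ?_)
  exact h.shift_sub s

/-- The converse direction, through which the product and conjugation rules are obtained. -/
theorem isWeakDeriv_of_hasDerivAt {f g : L2}
    (h : HasDerivAt (fun s => shift s f) g 0) : IsWeakDeriv f g := by
  intro φ hφ hc
  obtain ⟨ℓ, hℓ⟩ := exists_clm_integral_mul (memLp_of_contDiff hφ hc)
  have h₁ := hasDerivAt_integral_shift_mul f hφ hc 0
  have h₂ : HasDerivAt (fun s => ℓ (shift s f)) (ℓ g) 0 :=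
    (ℓ.restrictScalars ℝ).hasFDerivAt.comp_hasDerivAt (0 : ℝ) h
  simp only [hℓ] at h₂
  have := h₁.unique h₂
  rw [shift_zero] at this
  rw [← this, neg_neg]

/-! ### The Sobolev space `H¹` -/

/-- The inclusion `H¹ → L²` as a bounded linear map. -/
def toL2L : H1 →L[ℂ] L2 := (WithLp.fstL 2 ℂ L2 L2).comp H1.subtypeL

/-- The weak derivative `H¹ → L²` as a bounded linear map. -/
def dxL : H1 →L[ℂ] L2 := (WithLp.sndL 2 ℂ L2 L2).comp H1.subtypeL

theorem isWeakDeriv_dx (f : H1) : IsWeakDeriv (toL2 f) (dx f) := f.2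

/-- The element of `H¹` given by a function and its weak derivative. -/
def ofWeakDeriv (f g : L2) (h : IsWeakDeriv f g) : H1 := ⟨WithLp.toLp 2 (f, g), h⟩

theorem norm_sq_eq (f : H1) : ‖f‖ ^ 2 = ‖toL2 f‖ ^ 2 + ‖dx f‖ ^ 2 :=
  WithLp.prod_norm_sq_eq_of_L2 f.1

theorem norm_toL2_le (f : H1) : ‖toL2 f‖ ≤ ‖f‖ := by
  refine abs_le_of_sq_le_sq' ?_ (norm_nonneg _) |>.2
  rw [norm_sq_eq]
  linarith [sq_nonneg ‖dx f‖]

theorem norm_dx_le (f : H1) : ‖dx f‖ ≤ ‖f‖ := by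
  refine abs_le_of_sq_le_sq' ?_ (norm_nonneg _) |>.2
  rw [norm_sq_eq]
  linarith [sq_nonneg ‖toL2 f‖]

theorem norm_le_add (f : H1) : ‖f‖ ≤ ‖toL2 f‖ + ‖dx f‖ := by
  refine abs_le_of_sq_le_sq' ?_ (by positivity) |>.2
  rw [norm_sq_eq]
  nlinarith [norm_nonneg (toL2 f), norm_nonneg (dx f)]

theorem IsWeakDeriv.unique {f g g' : L2} (h : IsWeakDeriv f g) (h' : IsWeakDeriv f g') :
    g = g' :=
  ext_of_forall_integral_mul fun φ hφ hc => by
    rw [← neg_inj, ← h φ hφ hc, ← h' φ hφ hc]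

theorem toL2_injective : Function.Injective toL2 := by
  intro f g h
  refine Subtype.ext (WithLp.ofLp_injective 2 (Prod.ext h ?_))
  have hf := isWeakDeriv_dx f
  rw [h] at hf
  exact hf.unique (isWeakDeriv_dx g)

theorem isClosed_H1 : IsClosed (H1 : Set (WithLp 2 (L2 × L2))) := by
  have : (H1 : Set (WithLp 2 (L2 × L2))) =
      ⋂ (φ : ℝ → ℂ) (_ : ContDiff ℝ ∞ φ) (_ : HasCompactSupport φ),
        {p | ∫ x, p.fst x * deriv φ x = -∫ x, p.snd x * φ x} := by
    ext p
    simp only [mem_iInter, mem_ofPred_eq]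
    rfl
  rw [this]
  refine isClosed_iInter fun φ => isClosed_iInter fun hφ => isClosed_iInter fun hc => ?_
  obtain ⟨ℓ, hℓ⟩ := exists_clm_integral_mul (memLp_of_contDiff hφ hc)
  obtain ⟨ℓ', hℓ'⟩ := exists_clm_integral_mul
    (memLp_of_contDiff (contDiff_infty_iff_deriv.1 hφ).2 hc.deriv)
  simp only [← hℓ, ← hℓ']
  exact isClosed_eq (ℓ'.continuous.comp (WithLp.fstL 2 ℂ L2 L2).continuous)
    (ℓ.continuous.comp (WithLp.sndL 2 ℂ L2 L2).continuous).neg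

instance : CompleteSpace H1 := isClosed_H1.completeSpace_coe

/-- The translation group on `H¹`. -/
def shiftH (a : ℝ) : H1 →ₗᵢ[ℂ] H1 where
  toFun f := ofWeakDeriv (shift a (toL2 f)) (shift a (dx f)) ((isWeakDeriv_dx f).shift a)
  map_add' f g := toL2_injective ((shift a).map_add (toL2 f) (toL2 g))
  map_smul' c f := toL2_injective ((shift a).map_smul c (toL2 f))
  norm_map' f := by
    refine (sq_eq_sq₀ (norm_nonneg _) (norm_nonneg _)).1 ?_
    rw [norm_sq_eq, norm_sq_eq]
    change ‖shift a (toL2 f)‖ ^ 2 + ‖shift a (dx f)‖ ^ 2 = _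
    simp only [LinearIsometry.norm_map]

@[simp]
theorem toL2_shiftH (a : ℝ) (f : H1) : toL2 (shiftH a f) = shift a (toL2 f) := rfl

@[simp]
theorem dx_shiftH (a : ℝ) (f : H1) : dx (shiftH a f) = shift a (dx f) := rfl

theorem shiftH_shiftH (a b : ℝ) (f : H1) : shiftH a (shiftH b f) = shiftH (a + b) f :=
  toL2_injective (shift_shift a b (toL2 f))

@[simp]
theorem shiftH_zero (f : H1) : shiftH 0 f = f := toL2_injective (shift_zero (toL2 f))

theorem continuous_shiftH : Continuous fun p : ℝ × H1 => shiftH p.1 p.2 := by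
  refine Continuous.subtype_mk ?_ _
  refine (WithLp.prod_continuous_toLp 2 L2 L2).comp (Continuous.prodMk ?_ ?_)
  · exact continuous_shift.comp (continuous_fst.prodMk (toL2L.continuous.comp continuous_snd))
  · exact continuous_shift.comp (continuous_fst.prodMk (dxL.continuous.comp continuous_snd))

theorem continuous_shiftH_left (f : H1) : Continuous fun a => shiftH a f :=
  continuous_shiftH.comp (by fun_prop : Continuous fun a : ℝ => (a, f))

/-! ### The continuous representative

The kernel `1_{x > 0} e^{-x}` inverts `1 - ∂ₓ`, so that
`f(y) = ∫_{x > 0} e^{-x} (f - f')(x + y) dx`. -/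

/-- The one-sided exponential. -/
def expKernel : ℝ → ℂ := indicator (Ioi 0) fun x => (Real.exp (-x) : ℂ)

theorem memLp_expKernel : MemLp expKernel 2 := by
  have hm : AEStronglyMeasurable expKernel volume :=
    ((by fun_prop : Continuous fun x : ℝ => (Real.exp (-x) : ℂ)).aestronglyMeasurable).indicator
      measurableSet_Ioi
  refine (memLp_two_iff_integrable_sq_norm hm).2 ?_
  have h : (fun x => ‖expKernel x‖ ^ 2) = indicator (Ioi 0) fun x : ℝ => Real.exp (-2 * x) := by
    funext x
    by_cases hx : x ∈ Ioi (0 : ℝ)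
    · simp only [expKernel, indicator_of_mem hx, Complex.norm_real, Real.norm_eq_abs,
        Real.abs_exp, ← Real.exp_nat_mul]
      congr 1
      push_cast
      ring
    · simp [expKernel, indicator_of_notMem hx]
  rw [h, integrable_indicator_iff measurableSet_Ioi]
  exact integrableOn_exp_mul_Ioi (by norm_num) 0

/-- Evaluation of (the continuous representative of) an `H¹` function at `0`. -/
def evalZero : H1 →L[ℂ] ℂ :=
  (innerSL ℂ (memLp_expKernel.toLp : L2)).comp (toL2L - dxL)

/-- The continuous representative of an `H¹` function. -/
def rep (f : H1) (y : ℝ) : ℂ := evalZero (shiftH y f)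

theorem evalZero_apply (f : H1) :
    evalZero f = ∫ x, (toL2 f - dx f : L2) x * expKernel x := by
  change inner ℂ (memLp_expKernel.toLp : L2) (toL2 f - dx f) = _
  rw [L2.inner_def]
  refine integral_congr_ae ?_
  filter_upwards [memLp_expKernel.coeFn_toLp] with x hx
  rw [hx, RCLike.inner_apply]
  by_cases h : x ∈ Ioi (0 : ℝ)
  · simp [expKernel, indicator_of_mem h, -Complex.ofReal_exp, Complex.conj_ofReal]
  · simp [expKernel, indicator_of_notMem h]

theorem rep_apply (f : H1) (y : ℝ) :
    rep f y = ∫ x, (toL2 f - dx f : L2) (x + y) * expKernel x := by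
  rw [rep, evalZero_apply, toL2_shiftH, dx_shiftH, ← map_sub]
  refine integral_congr_ae ?_
  filter_upwards [coeFn_shift y (toL2 f - dx f)] with x hx
  rw [hx]

theorem continuous_rep (f : H1) : Continuous (rep f) :=
  evalZero.continuous.comp (continuous_shiftH_left f)

theorem norm_rep_le (f : H1) (y : ℝ) : ‖rep f y‖ ≤ ‖evalZero‖ * ‖f‖ := by
  simpa [rep] using evalZero.le_opNorm (shiftH y f)

theorem rep_shiftH (a : ℝ) (f : H1) (y : ℝ) : rep (shiftH a f) y = rep f (y + a) := by
  rw [rep, rep, shiftH_shiftH]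

theorem rep_add (f g : H1) (y : ℝ) : rep (f + g) y = rep f y + rep g y := by
  simp only [rep, map_add]

theorem rep_sub (f g : H1) (y : ℝ) : rep (f - g) y = rep f y - rep g y := by
  simp only [rep, map_sub]

theorem rep_smul (c : ℂ) (f : H1) (y : ℝ) : rep (c • f) y = c * rep f y := by
  simp only [rep, map_smul, smul_eq_mul]

/-- `∫_{x > 0} e^{-x} (c - c')(x) dx = c(0)` for the matrix coefficient `c` of the translation
group. -/
theorem integral_expKernel_mul (f : H1) {φ : ℝ → ℂ} (hφ : ContDiff ℝ ∞ φ)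
    (hc : HasCompactSupport φ) :
    ∫ x, expKernel x * ∫ y, shift x (toL2 f - dx f) y * φ y = ∫ y, toL2 f y * φ y := by
  obtain ⟨ℓ, hℓ⟩ := exists_clm_integral_mul (memLp_of_contDiff hφ hc)
  simp only [← hℓ, expKernel]
  set c : ℝ → ℂ := fun x => ℓ (shift x (toL2 f)) with hcdef
  set c' : ℝ → ℂ := fun x => ℓ (shift x (dx f)) with hc'def
  have hd : ∀ x, HasDerivAt c (c' x) x := fun x => by
    simpa only [hcdef, hc'def, hℓ] using (isWeakDeriv_dx f).hasDerivAt_integral hφ hc x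
  have hbc : ∀ x, ‖c x‖ ≤ ‖ℓ‖ * ‖toL2 f‖ := fun x => by
    simpa using ℓ.le_opNorm (shift x (toL2 f))
  have hbc' : ∀ x, ‖c' x‖ ≤ ‖ℓ‖ * ‖dx f‖ := fun x => by
    simpa using ℓ.le_opNorm (shift x (dx f))
  have hcc : Continuous c := ℓ.continuous.comp (continuous_shift_left _)
  have hcc' : Continuous c' := ℓ.continuous.comp (continuous_shift_left _)
  have hexp' : Integrable (fun x : ℝ => Real.exp (-x)) (volume.restrict (Ioi 0)) := by
    simpa [IntegrableOn] using integrableOn_exp_mul_Ioi (a := -1) (by norm_num) 0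
  have hexp : IntegrableOn (fun x : ℝ => (Real.exp (-x) : ℂ)) (Ioi 0) := hexp'.ofReal
  -- The integrand e^{-x}(c - c') has the primitive -e^{-x}c, which equals -c(0) at 0 and vanishes
  -- at infinity.
  have hF : ∀ x ∈ Ici (0 : ℝ), HasDerivAt (fun x : ℝ => -((Real.exp (-x) : ℂ) * c x))
      ((Real.exp (-x) : ℂ) * (c x - c' x)) x := fun x _ => by
    have h₁ : HasDerivAt (fun x : ℝ => (Real.exp (-x) : ℂ)) (-(Real.exp (-x) : ℂ)) x := by
      have := ((Real.hasDerivAt_exp (-x)).comp x (hasDerivAt_neg x)).ofReal_comp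
      simpa using this
    exact (h₁.fun_mul (hd x)).fun_neg.congr_deriv (by ring)
  have hint : IntegrableOn (fun x : ℝ => (Real.exp (-x) : ℂ) * (c x - c' x)) (Ioi 0) := by
    refine Integrable.mul_bdd (c := ‖ℓ‖ * ‖toL2 f‖ + ‖ℓ‖ * ‖dx f‖) hexp
      (hcc.sub hcc').aestronglyMeasurable (ae_of_all _ fun x => ?_)
    exact (norm_sub_le _ _).trans (add_le_add (hbc x) (hbc' x))
  have hlim : Tendsto (fun x : ℝ => -((Real.exp (-x) : ℂ) * c x)) atTop (𝓝 0) := by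
    rw [tendsto_zero_iff_norm_tendsto_zero]
    have h₁ : Tendsto (fun x : ℝ => Real.exp (-x) * (‖ℓ‖ * ‖toL2 f‖)) atTop (𝓝 0) := by
      simpa using (Real.tendsto_exp_neg_atTop_nhds_zero).mul_const (‖ℓ‖ * ‖toL2 f‖)
    refine squeeze_zero (fun _ => norm_nonneg _) (fun x => ?_) h₁
    rw [norm_neg, norm_mul, Complex.norm_real, Real.norm_eq_abs, Real.abs_exp]
    exact mul_le_mul_of_nonneg_left (hbc x) (Real.exp_pos _).le
  have key := integral_Ioi_of_hasDerivAt_of_tendsto' hF hint hlim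
  have h0 : ℓ (toL2 f) = c 0 := by simp [hcdef]
  rw [h0]
  have h₂ : (fun x => indicator (Ioi 0) (fun x : ℝ => (Real.exp (-x) : ℂ)) x
      * ℓ (shift x (toL2 f - dx f)))
      = indicator (Ioi 0) fun x : ℝ => (Real.exp (-x) : ℂ) * (c x - c' x) := by
    funext x
    by_cases hx : x ∈ Ioi (0 : ℝ)
    · simp only [indicator_of_mem hx, map_sub, hcdef, hc'def]
    · simp only [indicator_of_notMem hx, zero_mul]
  rw [h₂, integral_indicator measurableSet_Ioi, key]
  simp

/-- The hypothesis of Fubini in `toL2_ae_eq_rep`. The inner integral is bounded uniformly in the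
shift through ab ≤ a² + b², and φ supplies integrability in the other variable. -/
theorem integrable_expKernel_prod (w : L2) {φ : ℝ → ℂ} (hφ : Continuous φ)
    (hc : HasCompactSupport φ) :
    Integrable (fun p : ℝ × ℝ => w (p.2 + p.1) * expKernel p.2 * φ p.1)
      ((volume : Measure ℝ).prod volume) := by
  have hw : AEStronglyMeasurable (fun p : ℝ × ℝ => w (p.2 + p.1))
      ((volume : Measure ℝ).prod volume) := by
    have h := (Lp.aestronglyMeasurable w).comp_quasiMeasurePreserving
      (quasiMeasurePreserving_add (volume : Measure ℝ) volume)
    exact h.prod_swap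
  have hk : AEStronglyMeasurable expKernel volume := memLp_expKernel.1
  have hm : AEStronglyMeasurable (fun p : ℝ × ℝ => w (p.2 + p.1) * expKernel p.2 * φ p.1)
      ((volume : Measure ℝ).prod volume) :=
    (hw.mul hk.comp_snd).mul hφ.aestronglyMeasurable.comp_fst
  have hsec : ∀ y, MemLp (fun x => w (x + y)) 2 := fun y =>
    (Lp.memLp w).comp_measurePreserving (measurePreserving_add_right volume y)
  rw [integrable_prod_iff hm]
  refine ⟨ae_of_all _ fun y => ?_, ?_⟩
  · exact ((hsec y).integrable_mul memLp_expKernel).mul_const (φ y)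
  · have hki := (memLp_two_iff_integrable_sq_norm hk).1 memLp_expKernel
    have hbd : ∀ y, ‖∫ x, ‖w (x + y) * expKernel x * φ y‖‖
        ≤ ((∫ x, ‖w x‖ ^ 2) + ∫ x, ‖expKernel x‖ ^ 2) * ‖φ y‖ := fun y => by
      have hwi := (memLp_two_iff_integrable_sq_norm (hsec y).1).1 (hsec y)
      rw [Real.norm_of_nonneg (integral_nonneg fun x => norm_nonneg _),
        ← integral_add_right_eq_self (fun x => ‖w x‖ ^ 2) y, ← integral_add hwi hki,
        ← integral_mul_const]
      refine integral_mono ((((hsec y).integrable_mul memLp_expKernel).mul_const (φ y)).norm)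
        ((hwi.add hki).mul_const _) fun x => ?_
      simp only [norm_mul]
      refine mul_le_mul_of_nonneg_right ?_ (norm_nonneg _)
      nlinarith [sq_nonneg (‖w (x + y)‖ - ‖expKernel x‖), sq_nonneg ‖w (x + y)‖,
        sq_nonneg ‖expKernel x‖]
    have hφi : Integrable fun y =>
        ((∫ x, ‖w x‖ ^ 2) + ∫ x, ‖expKernel x‖ ^ 2) * ‖φ y‖ :=
      (hφ.integrable_of_hasCompactSupport hc).norm.const_mul _
    exact hφi.mono' hm.norm.integral_prod_right' (ae_of_all _ hbd)

/-- After testing against φ, Fubini moves the exponential kernel to the outer integral, where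
`integral_expKernel_mul` applies. -/
theorem toL2_ae_eq_rep (f : H1) : toL2 f =ᵐ[volume] rep f := by
  have key : ∀ᵐ x, toL2 f x - rep f x = 0 := by
    refine ae_eq_zero_of_forall_integral_mul_eq_zero
      ((locallyIntegrable_coe _).sub (continuous_rep f).locallyIntegrable) fun φ hφ hc => ?_
    have h₁ := integrable_mul_of_continuous (toL2 f) hφ.continuous hc
    have h₂ : Integrable fun x => rep f x * φ x :=
      ((continuous_rep f).mul hφ.continuous).integrable_of_hasCompactSupport hc.mul_left
    simp only [sub_mul]
    rw [integral_sub h₁ h₂, sub_eq_zero, ← integral_expKernel_mul f hφ hc]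
    simp only [rep_apply, ← integral_mul_const]
    rw [integral_integral_swap (integrable_expKernel_prod _ hφ.continuous hc)]
    refine integral_congr_ae (ae_of_all _ fun x => ?_)
    simp only
    rw [← integral_const_mul]
    refine integral_congr_ae ?_
    filter_upwards [coeFn_shift x (toL2 f - dx f)] with y hy
    rw [hy, add_comm y x]
    ring
  filter_upwards [key] with x hx using sub_eq_zero.1 hx

theorem rep_eq_of_ae_eq {f : H1} {g : ℝ → ℂ} (hg : Continuous g) (h : toL2 f =ᵐ[volume] g) :
    rep f = g :=
  ((continuous_rep f).ae_eq_iff_eq volume hg).1 ((toL2_ae_eq_rep f).symm.trans h)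

/-! ### `H¹` is an algebra -/

/-- Allows identities in H¹ to be checked pointwise on continuous representatives. -/
theorem rep_injective : Function.Injective rep := by
  intro f g h
  refine toL2_injective (Lp.ext ?_)
  filter_upwards [toL2_ae_eq_rep f, toL2_ae_eq_rep g] with x h₁ h₂
  rw [h₁, h₂, h]

theorem memLp_rep_mul (b : H1) (f : L2) : MemLp (fun x => rep b x * f x) 2 := by
  refine (Lp.memLp f).of_le_mul (c := ‖evalZero‖ * ‖b‖)
    ((continuous_rep b).aestronglyMeasurable.mul (Lp.aestronglyMeasurable f))
    (ae_of_all _ fun x => ?_)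
  rw [norm_mul]
  exact mul_le_mul_of_nonneg_right (norm_rep_le b x) (norm_nonneg _)

/-- The product of an `H¹` function and an `L²` function. -/
def mulL2 (b : H1) (f : L2) : L2 := (memLp_rep_mul b f).toLp

theorem coeFn_mulL2 (b : H1) (f : L2) : mulL2 b f =ᵐ[volume] fun x => rep b x * f x :=
  (memLp_rep_mul b f).coeFn_toLp

theorem norm_mulL2_le_of_forall {b : H1} {M : ℝ} (h : ∀ y, ‖rep b y‖ ≤ M) (f : L2) :
    ‖mulL2 b f‖ ≤ M * ‖f‖ := by
  refine Lp.norm_le_mul_norm_of_ae_le_mul ?_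
  filter_upwards [coeFn_mulL2 b f] with x hx
  rw [hx, norm_mul]
  exact mul_le_mul_of_nonneg_right (h x) (norm_nonneg _)

/-- The multiplication `H¹ × L² → L²` as a bounded bilinear map. -/
def mulL2L : H1 →L[ℂ] L2 →L[ℂ] L2 :=
  LinearMap.mkContinuous₂
    (LinearMap.mk₂ ℂ mulL2
      (fun b b' f => Lp.ext (by
        filter_upwards [coeFn_mulL2 (b + b') f, coeFn_mulL2 b f, coeFn_mulL2 b' f,
          Lp.coeFn_add (mulL2 b f) (mulL2 b' f)] with x h₁ h₂ h₃ h₄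
        rw [h₁, h₄, Pi.add_apply, h₂, h₃, rep_add, add_mul]))
      (fun c b f => Lp.ext (by
        filter_upwards [coeFn_mulL2 (c • b) f, coeFn_mulL2 b f,
          Lp.coeFn_smul c (mulL2 b f)] with x h₁ h₂ h₃
        rw [h₁, h₃, Pi.smul_apply, h₂, rep_smul, smul_eq_mul, mul_assoc]))
      (fun b f f' => Lp.ext (by
        filter_upwards [coeFn_mulL2 b (f + f'), coeFn_mulL2 b f, coeFn_mulL2 b f',
          Lp.coeFn_add (mulL2 b f) (mulL2 b f'), Lp.coeFn_add f f'] with x h₁ h₂ h₃ h₄ h₅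
        rw [h₁, h₄, Pi.add_apply, h₂, h₃, h₅, Pi.add_apply, mul_add]))
      (fun c b f => Lp.ext (by
        filter_upwards [coeFn_mulL2 b (c • f), coeFn_mulL2 b f,
          Lp.coeFn_smul c (mulL2 b f), Lp.coeFn_smul c f] with x h₁ h₂ h₃ h₄
        rw [h₁, h₃, Pi.smul_apply, h₂, h₄, Pi.smul_apply, smul_eq_mul, smul_eq_mul,
          mul_left_comm])))
    ‖evalZero‖ (fun b f => norm_mulL2_le_of_forall (norm_rep_le b) f)

theorem mulL2_toL2_comm (f g : H1) : mulL2 f (toL2 g) = mulL2 g (toL2 f) := by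
  refine Lp.ext ?_
  filter_upwards [coeFn_mulL2 f (toL2 g), coeFn_mulL2 g (toL2 f), toL2_ae_eq_rep f,
    toL2_ae_eq_rep g] with x h₁ h₂ h₃ h₄
  rw [h₁, h₂, h₃, h₄, mul_comm]

theorem shift_mulL2 (a : ℝ) (b : H1) (f : L2) :
    shift a (mulL2 b f) = mulL2 (shiftH a b) (shift a f) := by
  refine Lp.ext ?_
  filter_upwards [coeFn_shift a (mulL2 b f), ae_shift (coeFn_mulL2 b f) a,
    coeFn_mulL2 (shiftH a b) (shift a f), coeFn_shift a f] with x h₁ h₂ h₃ h₄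
  rw [h₁, h₂, h₃, h₄, rep_shiftH]

theorem tendsto_slope_shift (f : H1) :
    Tendsto (fun t : ℝ => t⁻¹ • (shift t (toL2 f) - toL2 f)) (𝓝[≠] 0) (𝓝 (dx f)) := by
  have h := hasDerivAt_iff_tendsto_slope_zero.1 ((isWeakDeriv_dx f).hasDerivAt 0)
  simpa using h

theorem tendsto_clm_apply₂ {E F G : Type*} [NormedAddCommGroup E] [NormedSpace ℂ E]
    [NormedAddCommGroup F] [NormedSpace ℂ F] [NormedAddCommGroup G] [NormedSpace ℂ G]
    (B : E →L[ℂ] F →L[ℂ] G) {ι : Type*} {l : Filter ι} {b : ι → E} {w : ι → F} {b₀ : E} {w₀ : F}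
    (hb : Tendsto b l (𝓝 b₀)) (hw : Tendsto w l (𝓝 w₀)) :
    Tendsto (fun i => B (b i) (w i)) l (𝓝 (B b₀ w₀)) :=
  (B.continuous₂.tendsto (b₀, w₀)).comp (hb.prodMk_nhds hw)

theorem tendsto_mulL2 {ι : Type*} {l : Filter ι} {b : ι → H1} {w : ι → L2} {b₀ : H1} {w₀ : L2}
    (hb : Tendsto b l (𝓝 b₀)) (hw : Tendsto w l (𝓝 w₀)) :
    Tendsto (fun i => mulL2 (b i) (w i)) l (𝓝 (mulL2 b₀ w₀)) :=
  tendsto_clm_apply₂ mulL2L hb hw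

/-- The discrete Leibniz rule: with τ the translation, τf (τg - g) + g (τf - f) = τ(fg) - fg. -/
theorem slope_shift_mulL2 (f g : H1) (t : ℝ) :
    mulL2 (shiftH t f) (t⁻¹ • (shift t (toL2 g) - toL2 g))
        + mulL2 g (t⁻¹ • (shift t (toL2 f) - toL2 f))
      = t⁻¹ • (shift t (mulL2 f (toL2 g)) - mulL2 f (toL2 g)) := by
  have hs : ∀ (b : H1) (w w' : L2), mulL2 b (t⁻¹ • (w - w')) = t⁻¹ • (mulL2 b w - mulL2 b w') :=
    fun b w w' => by
      have h₁ := ((mulL2L b).restrictScalars ℝ).map_smul t⁻¹ (w - w')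
      have h₂ := (mulL2L b).map_sub w w'
      exact h₁.trans (congrArg (t⁻¹ • ·) h₂)
  rw [hs, hs, ← smul_add, shift_mulL2, mulL2_toL2_comm (shiftH t f) g, mulL2_toL2_comm f g,
    toL2_shiftH, sub_add_sub_cancel]

/-- The product rule. -/
theorem isWeakDeriv_mulL2 (f g : H1) :
    IsWeakDeriv (mulL2 f (toL2 g)) (mulL2 f (dx g) + mulL2 g (dx f)) := by
  refine isWeakDeriv_of_hasDerivAt (hasDerivAt_iff_tendsto_slope_zero.2 ?_)
  -- Continuity of translations in H¹, not just in L², is needed because the first factor of `mulL2`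
  -- is controlled by its H¹ norm.
  have hf : Tendsto (fun t : ℝ => shiftH t f) (𝓝[≠] 0) (𝓝 f) := by
    have := (continuous_shiftH_left f).tendsto 0
    rw [shiftH_zero] at this
    exact this.mono_left nhdsWithin_le_nhds
  have h₁ := tendsto_mulL2 hf (tendsto_slope_shift g)
  have h₂ := tendsto_mulL2 (tendsto_const_nhds (x := g)) (tendsto_slope_shift f)
  refine (h₁.add h₂).congr fun t => ?_
  rw [slope_shift_mulL2, zero_add, shift_zero]

/-- The product of two `H¹` functions. -/
def mulH (f g : H1) : H1 := ofWeakDeriv _ _ (isWeakDeriv_mulL2 f g)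

theorem rep_mulH (f g : H1) (y : ℝ) : rep (mulH f g) y = rep f y * rep g y := by
  have h : toL2 (mulH f g) =ᵐ[volume] fun y => rep f y * rep g y := by
    filter_upwards [coeFn_mulL2 f (toL2 g), toL2_ae_eq_rep g] with x h₁ h₂
    rw [← h₂, ← h₁]
    rfl
  exact congrFun (rep_eq_of_ae_eq ((continuous_rep f).mul (continuous_rep g)) h) y

theorem norm_mulH_le_of_forall {f g : H1} {A B : ℝ} (hA : ∀ y, ‖rep f y‖ ≤ A)
    (hB : ∀ y, ‖rep g y‖ ≤ B) : ‖mulH f g‖ ≤ 2 * A * ‖g‖ + B * ‖f‖ := by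
  have hA0 : 0 ≤ A := (norm_nonneg _).trans (hA 0)
  have hB0 : 0 ≤ B := (norm_nonneg _).trans (hB 0)
  calc ‖mulH f g‖ ≤ ‖mulL2 f (toL2 g)‖ + ‖mulL2 f (dx g) + mulL2 g (dx f)‖ := norm_le_add _
    _ ≤ A * ‖toL2 g‖ + (A * ‖dx g‖ + B * ‖dx f‖) :=
      add_le_add (norm_mulL2_le_of_forall hA _) ((norm_add_le _ _).trans
        (add_le_add (norm_mulL2_le_of_forall hA _) (norm_mulL2_le_of_forall hB _)))
    _ ≤ A * ‖g‖ + (A * ‖g‖ + B * ‖f‖) := by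
      gcongr
      · exact norm_toL2_le g
      · exact norm_dx_le g
      · exact norm_dx_le f
    _ = 2 * A * ‖g‖ + B * ‖f‖ := by ring

theorem norm_mulH_le (f g : H1) : ‖mulH f g‖ ≤ 3 * ‖evalZero‖ * ‖f‖ * ‖g‖ := by
  refine (norm_mulH_le_of_forall (norm_rep_le f) (norm_rep_le g)).trans (le_of_eq ?_)
  ring

theorem mulH_sub_mulH (f g f' g' : H1) :
    mulH f g - mulH f' g' = mulH (f - f') g + mulH f' (g - g') := by
  refine rep_injective (funext fun y => ?_)
  simp only [rep_sub, rep_add, rep_mulH]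
  ring

/-! ### Complex conjugation on `H¹` -/

/-- Complex conjugation on `L²`. -/
def conjL2 : L2 →L[ℝ] L2 := (Complex.conjCLE : ℂ →L[ℝ] ℂ).compLpL 2 volume

theorem coeFn_conjL2 (f : L2) : conjL2 f =ᵐ[volume] fun x => conj (f x) :=
  (Complex.conjCLE : ℂ →L[ℝ] ℂ).coeFn_compLpL f

theorem norm_conjL2 (f : L2) : ‖conjL2 f‖ = ‖f‖ := by
  refine le_antisymm (Lp.norm_le_norm_of_ae_le ?_) (Lp.norm_le_norm_of_ae_le ?_) <;>
  · filter_upwards [coeFn_conjL2 f] with x hx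
    simp [hx]

theorem shift_conjL2 (a : ℝ) (f : L2) : shift a (conjL2 f) = conjL2 (shift a f) := by
  refine Lp.ext ?_
  filter_upwards [coeFn_shift a (conjL2 f), ae_shift (coeFn_conjL2 f) a,
    coeFn_conjL2 (shift a f), coeFn_shift a f] with x h₁ h₂ h₃ h₄
  rw [h₁, h₂, h₃, h₄]

theorem IsWeakDeriv.conj {f g : L2} (h : IsWeakDeriv f g) :
    IsWeakDeriv (conjL2 f) (conjL2 g) := by
  refine isWeakDeriv_of_hasDerivAt ?_
  have h₁ := conjL2.hasFDerivAt.comp_hasDerivAt (0 : ℝ) (h.hasDerivAt 0)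
  rw [shift_zero] at h₁
  exact h₁.congr_of_eventuallyEq (Eventually.of_forall fun a => shift_conjL2 a f)

/-- Complex conjugation on `H¹`. -/
def conjH (f : H1) : H1 := ofWeakDeriv _ _ (isWeakDeriv_dx f).conj

theorem rep_conjH (f : H1) (y : ℝ) : rep (conjH f) y = conj (rep f y) := by
  have h : toL2 (conjH f) =ᵐ[volume] fun y => conj (rep f y) := by
    filter_upwards [coeFn_conjL2 (toL2 f), toL2_ae_eq_rep f] with x h₁ h₂
    rw [← h₂, ← h₁]
    rfl
  exact congrFun (rep_eq_of_ae_eq (Complex.continuous_conj.comp (continuous_rep f)) h) y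

theorem norm_conjH (f : H1) : ‖conjH f‖ = ‖f‖ := by
  refine (sq_eq_sq₀ (norm_nonneg _) (norm_nonneg _)).1 ?_
  rw [norm_sq_eq, norm_sq_eq]
  change ‖conjL2 (toL2 f)‖ ^ 2 + ‖conjL2 (dx f)‖ ^ 2 = _
  rw [norm_conjL2, norm_conjL2]

theorem conjH_sub (f g : H1) : conjH f - conjH g = conjH (f - g) := by
  refine rep_injective (funext fun y => ?_)
  simp only [rep_sub, rep_conjH, map_sub]

/-! ### Tame maps on `H¹ × H¹` -/

/-- A map `H¹ × H¹ → H¹` that is Lipschitz on bounded sets and has linear growth on sets that are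
bounded in the supremum norm. -/
structure Tame (F : H1 × H1 → H1) : Prop where
  lipschitz : ∀ R : ℝ, ∃ K : ℝ, 0 ≤ K ∧ ∀ X Y : H1 × H1, ‖X‖ ≤ R → ‖Y‖ ≤ R →
    ‖F X - F Y‖ ≤ K * ‖X - Y‖
  growth : ∀ M : ℝ, ∃ K : ℝ, 0 ≤ K ∧ ∀ X : H1 × H1, (∀ y, ‖rep X.1 y‖ ≤ M) →
    (∀ y, ‖rep X.2 y‖ ≤ M) → (∀ y, ‖rep (F X) y‖ ≤ K) ∧ ‖F X‖ ≤ K * ‖X‖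

namespace Tame

variable {F G : H1 × H1 → H1}

theorem fst : Tame Prod.fst where
  lipschitz _ := ⟨1, zero_le_one, fun X Y _ _ => by simpa using norm_fst_le (X - Y)⟩
  -- One constant serves as supremum bound and as growth factor, hence the maximum with 1.
  growth M := ⟨max M 1, by positivity, fun X h _ =>
    ⟨fun y => (h y).trans (le_max_left _ _), (norm_fst_le X).trans
      (le_mul_of_one_le_left (norm_nonneg _) (le_max_right _ _))⟩⟩

theorem snd : Tame Prod.snd where
  lipschitz _ := ⟨1, zero_le_one, fun X Y _ _ => by simpa using norm_snd_le (X - Y)⟩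
  growth M := ⟨max M 1, by positivity, fun X _ h =>
    ⟨fun y => (h y).trans (le_max_left _ _), (norm_snd_le X).trans
      (le_mul_of_one_le_left (norm_nonneg _) (le_max_right _ _))⟩⟩

theorem conj_comp (hF : Tame F) : Tame fun X => conjH (F X) where
  lipschitz R := by
    obtain ⟨K, hK, h⟩ := hF.lipschitz R
    exact ⟨K, hK, fun X Y hX hY => by rw [conjH_sub, norm_conjH]; exact h X Y hX hY⟩
  growth M := by
    obtain ⟨K, hK, h⟩ := hF.growth M
    refine ⟨K, hK, fun X h₁ h₂ => ⟨fun y => ?_, ?_⟩⟩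
    · rw [rep_conjH, RCLike.norm_conj]
      exact (h X h₁ h₂).1 y
    · rw [norm_conjH]
      exact (h X h₁ h₂).2

theorem add (hF : Tame F) (hG : Tame G) : Tame fun X => F X + G X where
  lipschitz R := by
    obtain ⟨K, hK, h⟩ := hF.lipschitz R
    obtain ⟨K', hK', h'⟩ := hG.lipschitz R
    refine ⟨K + K', by positivity, fun X Y hX hY => ?_⟩
    rw [add_sub_add_comm, add_mul]
    exact (norm_add_le _ _).trans (add_le_add (h X Y hX hY) (h' X Y hX hY))
  growth M := by
    obtain ⟨K, hK, h⟩ := hF.growth M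
    obtain ⟨K', hK', h'⟩ := hG.growth M
    refine ⟨K + K', by positivity, fun X h₁ h₂ => ⟨fun y => ?_, ?_⟩⟩
    · rw [rep_add]
      exact (norm_add_le _ _).trans (add_le_add ((h X h₁ h₂).1 y) ((h' X h₁ h₂).1 y))
    · rw [add_mul]
      exact (norm_add_le _ _).trans (add_le_add (h X h₁ h₂).2 (h' X h₁ h₂).2)

theorem smul (c : ℂ) (hF : Tame F) : Tame fun X => c • F X where
  lipschitz R := by
    obtain ⟨K, hK, h⟩ := hF.lipschitz R
    refine ⟨‖c‖ * K, by positivity, fun X Y hX hY => ?_⟩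
    rw [← smul_sub, norm_smul, mul_assoc]
    exact mul_le_mul_of_nonneg_left (h X Y hX hY) (norm_nonneg _)
  growth M := by
    obtain ⟨K, hK, h⟩ := hF.growth M
    refine ⟨‖c‖ * K, by positivity, fun X h₁ h₂ => ⟨fun y => ?_, ?_⟩⟩
    · rw [rep_smul, norm_mul]
      exact mul_le_mul_of_nonneg_left ((h X h₁ h₂).1 y) (norm_nonneg _)
    · rw [norm_smul, mul_assoc]
      exact mul_le_mul_of_nonneg_left (h X h₁ h₂).2 (norm_nonneg _)

theorem exists_norm_le (hF : Tame F) (R : ℝ) :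
    ∃ L : ℝ, 0 ≤ L ∧ ∀ X : H1 × H1, ‖X‖ ≤ R → ‖F X‖ ≤ L := by
  obtain ⟨K, hK, h⟩ := hF.growth (‖evalZero‖ * R)
  refine ⟨K * max R 0, by positivity, fun X hX => ?_⟩
  refine (h X (fun y => (norm_rep_le _ y).trans ?_) (fun y => (norm_rep_le _ y).trans ?_)).2.trans ?_
  · gcongr
    exact (norm_fst_le X).trans hX
  · gcongr
    exact (norm_snd_le X).trans hX
  · gcongr
    exact hX.trans (le_max_left _ _)

/-- Linear growth survives products because the H¹ norm of a product pairs the supremum of one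
factor with the H¹ norm of the other. This is why `growth` also carries the supremum bound. -/
theorem mul (hF : Tame F) (hG : Tame G) : Tame fun X => mulH (F X) (G X) where
  lipschitz R := by
    obtain ⟨K, hK, h⟩ := hF.lipschitz R
    obtain ⟨K', hK', h'⟩ := hG.lipschitz R
    obtain ⟨L, hL, hFL⟩ := hF.exists_norm_le R
    obtain ⟨L', hL', hGL⟩ := hG.exists_norm_le R
    refine ⟨3 * ‖evalZero‖ * (K * L' + L * K'), by positivity, fun X Y hX hY => ?_⟩
    rw [mulH_sub_mulH]
    calc _ ≤ 3 * ‖evalZero‖ * ‖F X - F Y‖ * ‖G X‖ + 3 * ‖evalZero‖ * ‖F Y‖ * ‖G X - G Y‖ :=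
          (norm_add_le _ _).trans (add_le_add (norm_mulH_le _ _) (norm_mulH_le _ _))
      _ ≤ 3 * ‖evalZero‖ * (K * ‖X - Y‖) * L' + 3 * ‖evalZero‖ * L * (K' * ‖X - Y‖) := by
          gcongr
          exacts [h X Y hX hY, hGL X hX, hFL Y hY, h' X Y hX hY]
      _ = _ := by ring
  growth M := by
    obtain ⟨K, hK, h⟩ := hF.growth M
    obtain ⟨K', hK', h'⟩ := hG.growth M
    refine ⟨3 * K * K', by positivity, fun X h₁ h₂ => ⟨fun y => ?_, ?_⟩⟩
    · rw [rep_mulH, norm_mul]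
      refine (mul_le_mul ((h X h₁ h₂).1 y) ((h' X h₁ h₂).1 y) (norm_nonneg _) hK).trans ?_
      nlinarith [mul_nonneg hK hK']
    · calc _ ≤ 2 * K * ‖G X‖ + K' * ‖F X‖ :=
            norm_mulH_le_of_forall (h X h₁ h₂).1 (h' X h₁ h₂).1
        _ ≤ 2 * K * (K' * ‖X‖) + K' * (K * ‖X‖) := by
            gcongr
            exacts [(h' X h₁ h₂).2, (h X h₁ h₂).2]
        _ = _ := by ring

theorem continuous (hF : Tame F) : Continuous F := by
  refine continuous_iff_continuousAt.2 fun X => ?_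
  obtain ⟨K, hK, h⟩ := hF.lipschitz (‖X‖ + 1)
  rw [ContinuousAt, tendsto_iff_norm_sub_tendsto_zero]
  have h₁ : Tendsto (fun Y => K * ‖Y - X‖) (𝓝 X) (𝓝 0) := by
    have : Continuous fun Y => K * ‖Y - X‖ := by fun_prop
    simpa using this.tendsto X
  refine squeeze_zero' (Eventually.of_forall fun _ => norm_nonneg _) ?_ h₁
  filter_upwards [Metric.ball_mem_nhds X one_pos] with Y hY
  refine h Y X ?_ (by linarith)
  have := norm_le_norm_add_norm_sub' Y X
  rw [mem_ball_iff_norm] at hY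
  linarith

end Tame

/-- Cubic nonlinearities act on `H¹` by tame maps. -/
theorem IsCubic.exists_tame {N : ℂ → ℂ → ℂ} (hN : IsCubic N) {P Q : H1 × H1 → H1}
    (hP : Tame P) (hQ : Tame Q) :
    ∃ F : H1 × H1 → H1, Tame F ∧ ∀ X y, rep (F X) y = N (rep (P X) y) (rep (Q X) y) := by
  obtain ⟨a, b, h⟩ := hN
  have hS : ∀ c : Fin 3 → ℂ, Tame fun X => c 0 • mulH (Q X) (conjH (Q X))
      + c 1 • mulH (Q X) (Q X) + c 2 • mulH (conjH (Q X)) (conjH (Q X)) := fun c =>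
    (((hQ.mul hQ.conj_comp).smul _).add ((hQ.mul hQ).smul _)).add ((hQ.conj_comp.mul hQ.conj_comp).smul _)
  refine ⟨_, (hP.mul (hS a)).add (hP.conj_comp.mul (hS b)), fun X y => ?_⟩
  simp only [h, rep_add, rep_mulH, rep_smul, rep_conjH, Complex.mul_conj', sq]

/-- Cubic nonlinearities are linear in the first and quadratic in the second variable. -/
theorem IsCubic.exists_norm_le {N : ℂ → ℂ → ℂ} (hN : IsCubic N) :
    ∃ C : ℝ, 0 ≤ C ∧ ∀ p q : ℂ, ‖N p q‖ ≤ C * ‖p‖ * ‖q‖ ^ 2 := by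
  obtain ⟨a, b, h⟩ := hN
  have hS : ∀ (c : Fin 3 → ℂ) (q : ℂ), ‖c 0 * (‖q‖ : ℂ) ^ 2 + c 1 * q ^ 2 + c 2 * conj q ^ 2‖
      ≤ (‖c 0‖ + ‖c 1‖ + ‖c 2‖) * ‖q‖ ^ 2 := fun c q => by
    refine norm_add₃_le.trans (le_of_eq ?_)
    simp only [norm_mul, norm_pow, RCLike.norm_conj, Complex.norm_real, norm_norm]
    ring
  refine ⟨(‖a 0‖ + ‖a 1‖ + ‖a 2‖) + (‖b 0‖ + ‖b 1‖ + ‖b 2‖), by positivity, fun p q => ?_⟩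
  rw [h]
  refine (norm_add_le _ _).trans ?_
  rw [norm_mul, norm_mul, RCLike.norm_conj]
  nlinarith [mul_le_mul_of_nonneg_left (hS a q) (norm_nonneg p),
    mul_le_mul_of_nonneg_left (hS b q) (norm_nonneg p)]

/-! ### Moving frames -/

/-- The time derivative of a differentiable curve in `L²` seen from a frame moving with
velocity `c`. -/
theorem hasDerivWithinAt_shift {q : ℝ → H1} {B : L2} {s : Set ℝ} {t : ℝ} (c : ℝ)
    (hq : HasDerivWithinAt (fun r => toL2 (q r)) B s t) :
    HasDerivWithinAt (fun r => shift (c * r) (toL2 (q r)))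
      (shift (c * t) (B + c • dx (q t))) s t := by
  have h₁ := hasDerivWithinAt_iff_tendsto_slope.1 hq
  have h₂ : HasDerivWithinAt (fun r => shift (c * r) (toL2 (q t)))
      (c • shift (c * t) (dx (q t))) s t := by
    have h := ((isWeakDeriv_dx (q t)).hasDerivAt (c * t)).scomp t
      ((hasDerivAt_id t).const_mul c)
    rw [mul_one] at h
    exact h.hasDerivWithinAt
  have hc : Tendsto (fun r : ℝ => c * r) (𝓝[s \ {t}] t) (𝓝 (c * t)) :=
    ((continuous_const.mul continuous_id).tendsto t).mono_left nhdsWithin_le_nhds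
  -- The difference quotient splits into the moving translation applied to the slope of q, handled
  -- by joint continuity, and the slope of the translation orbit of the fixed H¹ function q(t).
  have h₃ := (continuous_shift.tendsto (c * t, B)).comp (hc.prodMk_nhds h₁)
  have h₄ := h₃.add (hasDerivWithinAt_iff_tendsto_slope.1 h₂)
  refine hasDerivWithinAt_iff_tendsto_slope.2 ?_
  have hval : shift (c * t) (B + c • dx (q t))
      = shift (c * t) B + c • shift (c * t) (dx (q t)) := by
    rw [map_add]
    congr 1
    exact ((shift (c * t)).toLinearMap.restrictScalars ℝ).map_smul c (dx (q t))
  rw [hval]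
  refine h₄.congr fun r => ?_
  have hs : ∀ (k : ℝ) (w : L2), shift (c * r) (k • w) = k • shift (c * r) w := fun k w =>
    ((shift (c * r)).toLinearMap.restrictScalars ℝ).map_smul k w
  simp only [Function.comp_apply, slope, vsub_eq_sub, hs, map_sub]
  rw [← smul_add, sub_add_sub_cancel]

/-! ### Charge on a set and its flux -/

/-- Restriction of an `L²` function to a set. -/
def restr (S : Set ℝ) : L2 →L[ℝ] Lp ℂ 2 (volume.restrict S) :=
  LpToLpRestrictCLM ℝ ℂ ℝ volume 2 S

/-- The charge `∫_S |f|²`. -/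
def charge (S : Set ℝ) (f : L2) : ℝ := ‖restr S f‖ ^ 2

/-- The polarised charge `Re ∫_S f̄ g`. -/
def flux (S : Set ℝ) (f g : L2) : ℝ := inner ℝ (restr S f) (restr S g)

theorem flux_add (S : Set ℝ) (f g h : L2) : flux S f (g + h) = flux S f g + flux S f h := by
  rw [flux, map_add, inner_add_right]
  rfl

theorem flux_smul (S : Set ℝ) (f g : L2) (c : ℝ) : flux S f (c • g) = c * flux S f g := by
  rw [flux, map_smul, inner_smul_right]
  rfl

theorem restr_rep (S : Set ℝ) (f : H1) : restr S (toL2 f) =ᵐ[volume.restrict S] rep f :=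
  (LpToLpRestrictCLM_coeFn ℝ S (toL2 f)).trans (ae_restrict_of_ae (toL2_ae_eq_rep f))

theorem flux_eq_integral (S : Set ℝ) (f g : H1) :
    flux S (toL2 f) (toL2 g) = ∫ x in S, (conj (rep f x) * rep g x).re := by
  rw [flux, L2.inner_def]
  refine integral_congr_ae ?_
  filter_upwards [restr_rep S f, restr_rep S g] with x h₁ h₂
  rw [h₁, h₂, Complex.inner, mul_comm]

theorem integrableOn_flux (S : Set ℝ) (f g : H1) :
    IntegrableOn (fun x => (conj (rep f x) * rep g x).re) S := by
  refine (L2.integrable_inner (𝕜 := ℝ) (restr S (toL2 f)) (restr S (toL2 g))).congr ?_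
  filter_upwards [restr_rep S f, restr_rep S g] with x h₁ h₂
  rw [h₁, h₂, Complex.inner, mul_comm]

theorem charge_eq_flux (S : Set ℝ) (f : L2) : charge S f = flux S f f :=
  (real_inner_self_eq_norm_sq _).symm

theorem re_conj_mul_self (z : ℂ) : (conj z * z).re = ‖z‖ ^ 2 := by
  rw [Complex.conj_mul', ← Complex.ofReal_pow, Complex.ofReal_re]

theorem charge_eq_integral (S : Set ℝ) (f : H1) :
    charge S (toL2 f) = ∫ x in S, ‖rep f x‖ ^ 2 := by
  rw [charge_eq_flux, flux_eq_integral]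
  simp only [re_conj_mul_self]

theorem integrableOn_norm_sq_rep (S : Set ℝ) (f : H1) :
    IntegrableOn (fun x => ‖rep f x‖ ^ 2) S := by
  simpa only [re_conj_mul_self] using integrableOn_flux S f f

theorem charge_nonneg (S : Set ℝ) (f : L2) : 0 ≤ charge S f := sq_nonneg _

theorem charge_le (S : Set ℝ) (f : L2) : charge S f ≤ ‖f‖ ^ 2 := by
  have h : ‖restr S f‖ ≤ ‖f‖ := norm_Lp_toLp_restrict_le S f
  exact pow_le_pow_left₀ (norm_nonneg _) h 2

theorem hasDerivWithinAt_charge (S : Set ℝ) {w : ℝ → L2} {w' : L2} {s : Set ℝ} {t : ℝ}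
    (hw : HasDerivWithinAt w w' s t) :
    HasDerivWithinAt (fun r => charge S (w r)) (2 * flux S (w t) w') s t :=
  ((restr S).hasFDerivAt.comp_hasDerivWithinAt t hw).norm_sq

theorem charge_shift (S : Set ℝ) (a : ℝ) (f : H1) :
    charge ((· + a) ⁻¹' S) (shift a (toL2 f)) = ∫ x in S, ‖rep f x‖ ^ 2 := by
  rw [← toL2_shiftH, charge_eq_integral]
  simp only [rep_shiftH]
  exact (measurePreserving_add_right volume a).setIntegral_preimage_emb
    (measurableEmbedding_addRight a) (fun x => ‖rep f x‖ ^ 2) S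

theorem hasDerivAt_charge_shift (S : Set ℝ) (f : H1) :
    HasDerivAt (fun a => charge S (shift a (toL2 f))) (2 * flux S (toL2 f) (dx f)) 0 := by
  have h := hasDerivWithinAt_charge S ((isWeakDeriv_dx f).hasDerivAt 0).hasDerivWithinAt (s := univ)
  rw [shift_zero, shift_zero] at h
  exact h.hasDerivAt univ_mem

theorem hasDerivAt_integral_rep (f : H1) (y : ℝ) :
    HasDerivAt (fun a => ∫ x in y..y + a, ‖rep f x‖ ^ 2) (‖rep f y‖ ^ 2) 0 := by
  have hc : Continuous fun x => ‖rep f x‖ ^ 2 := (continuous_rep f).norm.pow 2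
  have h := intervalIntegral.integral_hasDerivAt_right (hc.intervalIntegrable y (y + 0))
    (hc.stronglyMeasurableAtFilter _ _) hc.continuousAt
  have h' := h.comp_const_add y 0
  rwa [add_zero] at h'

/-- The charge flux through the left end of a half-line. -/
theorem flux_Ioi_dx (f : H1) (y : ℝ) :
    2 * flux (Ioi y) (toL2 f) (dx f) = -‖rep f y‖ ^ 2 := by
  -- The charge of the translate on the half-line is differentiated in two ways: as a squared norm,
  -- and as the original charge minus the integral of |f|² from y to y + a.
  refine (hasDerivAt_charge_shift (Ioi y) f).unique ?_
  refine ((hasDerivAt_integral_rep f y).const_sub (charge (Ioi y) (toL2 f))).congr_of_eventuallyEq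
    (Eventually.of_forall fun a => ?_)
  have h := charge_shift (Ioi (y + a)) a f
  rw [preimage_add_const_Ioi, add_sub_cancel_right] at h
  simp only
  rw [h, charge_eq_integral, ← intervalIntegral.integral_Ioi_sub_Ioi'
    (integrableOn_norm_sq_rep _ f) (integrableOn_norm_sq_rep _ f), sub_sub_cancel]

/-- The charge flux through the right end of a half-line. -/
theorem flux_Iic_dx (f : H1) (y : ℝ) :
    2 * flux (Iic y) (toL2 f) (dx f) = ‖rep f y‖ ^ 2 := by
  refine (hasDerivAt_charge_shift (Iic y) f).unique ?_
  refine ((hasDerivAt_integral_rep f y).const_add (charge (Iic y) (toL2 f))).congr_of_eventuallyEq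
    (Eventually.of_forall fun a => ?_)
  have h := charge_shift (Iic (y + a)) a f
  rw [preimage_add_const_Iic, add_sub_cancel_right] at h
  simp only
  rw [h, charge_eq_integral, ← intervalIntegral.integral_Iic_sub_Iic
    (integrableOn_norm_sq_rep _ f) (integrableOn_norm_sq_rep _ f), add_sub_cancel]

/-- The balance of charge on a half-line bounded by a characteristic. -/
theorem hasDerivWithinAt_charge_add {S : Set ℝ} {c y : ℝ}
    (hS : ∀ f : H1, c * flux S (toL2 f) (dx f) = -‖rep f y‖ ^ 2)
    {P Q : ℝ → H1} {A B : H1} {s : Set ℝ} {t : ℝ} (hP : HasDerivWithinAt P A s t)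
    (hQ : HasDerivWithinAt Q B s t)
    (hcancel : ∀ x, (conj (rep (P t) x) * rep A x
      + conj (rep (shiftH (c * t) (Q t)) x) * rep (shiftH (c * t) B) x).re = 0) :
    HasDerivWithinAt
      (fun r => charge S (toL2 (P r)) + charge S (shift (c * r) (toL2 (Q r))))
      (-2 * ‖rep (shiftH (c * t) (Q t)) y‖ ^ 2) s t := by
  have hP' : HasDerivWithinAt (fun r => toL2 (P r)) (toL2 A) s t :=
    (toL2L.restrictScalars ℝ).hasFDerivAt.comp_hasDerivWithinAt t hP
  have hQ' : HasDerivWithinAt (fun r => toL2 (Q r)) (toL2 B) s t :=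
    (toL2L.restrictScalars ℝ).hasFDerivAt.comp_hasDerivWithinAt t hQ
  refine ((hasDerivWithinAt_charge S hP').add
    (hasDerivWithinAt_charge S (hasDerivWithinAt_shift c hQ'))).congr_deriv ?_
  have hs : shift (c * t) (c • dx (Q t)) = c • dx (shiftH (c * t) (Q t)) :=
    ((shift (c * t)).toLinearMap.restrictScalars ℝ).map_smul c (dx (Q t))
  rw [map_add, hs, ← toL2_shiftH, ← toL2_shiftH, flux_add, flux_smul, hS]
  -- The sources cancel pointwise, so only the transport of Q through the endpoint of S contributes.
  have h0 : flux S (toL2 (P t)) (toL2 A)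
      + flux S (toL2 (shiftH (c * t) (Q t))) (toL2 (shiftH (c * t) B)) = 0 := by
    rw [flux_eq_integral, flux_eq_integral,
      ← integral_add (integrableOn_flux S _ _) (integrableOn_flux S _ _)]
    simp only [← Complex.add_re, hcancel, integral_zero]
  linear_combination 2 * h0

/-! ### The supremum bound -/

/-- A Gronwall inequality along a characteristic, in which the quadratic coefficient `w²` is
controlled by the decrease of a nonnegative quantity `E`. -/
theorem norm_sq_le_of_charge {T m C : ℝ} (hm : 0 ≤ m) (hC : 0 ≤ C) {p a : ℝ → ℂ} {E w : ℝ → ℝ}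
    (hp : ∀ t ∈ Icc 0 T, HasDerivWithinAt p (a t) (Icc 0 T) t)
    (hE : ∀ t ∈ Icc 0 T, HasDerivWithinAt E (-2 * w t ^ 2) (Icc 0 T) t)
    (hE0 : ∀ t ∈ Icc 0 T, 0 ≤ E t)
    (ha : ∀ t ∈ Icc 0 T, (conj (p t) * a t).re
      ≤ m * ‖p t‖ * w t + C * ‖p t‖ ^ 2 * w t ^ 2)
    {t : ℝ} (ht : t ∈ Icc 0 T) :
    ‖p t‖ ^ 2 ≤ (‖p 0‖ ^ 2 + m * E 0) * Real.exp (C * E 0 + m * T) := by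
  have h0 : (0 : ℝ) ∈ Icc 0 T := ⟨le_rfl, ht.1.trans ht.2⟩
  have hint : interior (Icc (0 : ℝ) T) ⊆ Icc 0 T := interior_subset
  have hEanti : AntitoneOn E (Icc 0 T) :=
    antitoneOn_of_hasDerivWithinAt_nonpos (convex_Icc 0 T)
      (fun r hr => (hE r hr).continuousWithinAt)
      (fun r hr => (hE r (hint hr)).mono hint)
      (fun r _ => by nlinarith [sq_nonneg (w r)])
  -- Integrating factor: since E' = -2w², its derivative produces -2C‖p‖²w² against the quadratic
  -- source term and -m‖p‖² for the mass term.
  set e : ℝ → ℝ := fun r => Real.exp (C * (E r - E 0) - m * r) with he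
  have hΦ : ∀ r ∈ Icc 0 T, HasDerivWithinAt (fun r => ‖p r‖ ^ 2 * e r + m / 2 * E r)
      (2 * (conj (p r) * a r).re * e r
        + ‖p r‖ ^ 2 * (e r * (C * (-2 * w r ^ 2) - m)) + m / 2 * (-2 * w r ^ 2))
      (Icc 0 T) r := fun r hr => by
    have h₁ : HasDerivWithinAt (fun r => ‖p r‖ ^ 2) (2 * (conj (p r) * a r).re) (Icc 0 T) r := by
      have := (hp r hr).norm_sq
      rwa [Complex.inner, mul_comm (a r)] at this
    have h₂ : HasDerivWithinAt e (e r * (C * (-2 * w r ^ 2) - m)) (Icc 0 T) r := by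
      have := ((((hE r hr).sub_const (E 0)).const_mul C).fun_sub
        ((hasDerivWithinAt_id r _).const_mul m)).exp
      simpa [he] using this
    exact (h₁.fun_mul h₂).fun_add ((hE r hr).const_mul (m / 2))
  have hanti : AntitoneOn (fun r => ‖p r‖ ^ 2 * e r + m / 2 * E r) (Icc 0 T) := by
    refine antitoneOn_of_hasDerivWithinAt_nonpos (convex_Icc 0 T)
      (fun r hr => (hΦ r hr).continuousWithinAt) (fun r hr => (hΦ r (hint hr)).mono hint)
      (fun r hr => ?_)
    have hr' := hint hr
    have he0 : 0 < e r := Real.exp_pos _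
    have he1 : e r ≤ 1 := by
      refine Real.exp_le_one_iff.2 ?_
      have h₁ : C * (E r - E 0) ≤ 0 :=
        mul_nonpos_of_nonneg_of_nonpos hC (sub_nonpos.2 (hEanti h0 hr' hr'.1))
      have h₂ := mul_nonneg hm hr'.1
      linarith
    have h₁ := mul_le_mul_of_nonneg_right (ha r hr') he0.le
    -- What remains is 2m‖p‖w - m‖p‖² ≤ m w², weighted by e ≤ 1; the term (m/2)E, with derivative -m
    -- w², absorbs it.
    have h₂ : 0 ≤ m * e r * (‖p r‖ - w r) ^ 2 := by positivity
    have h₃ : m * w r ^ 2 * e r ≤ m * w r ^ 2 * 1 :=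
      mul_le_mul_of_nonneg_left he1 (by positivity)
    nlinarith
  have key := hanti h0 ht ht.1
  have he0 : e 0 = 1 := by simp [he]
  simp only [he0, mul_one] at key
  have hEt := hE0 t ht
  have hEz := hE0 0 h0
  have hle : ‖p t‖ ^ 2 * e t ≤ ‖p 0‖ ^ 2 + m * E 0 := by
    have h₁ := mul_nonneg hm hEt
    have h₂ := mul_nonneg hm hEz
    linarith
  have hexp : 1 ≤ e t * Real.exp (C * E 0 + m * T) := by
    rw [he, ← Real.exp_add]
    refine Real.one_le_exp ?_
    have h₁ := mul_nonneg hC hEt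
    have h₂ := mul_le_mul_of_nonneg_left ht.2 hm
    linarith
  calc ‖p t‖ ^ 2 ≤ ‖p t‖ ^ 2 * (e t * Real.exp (C * E 0 + m * T)) :=
        le_mul_of_one_le_right (sq_nonneg _) hexp
    _ = ‖p t‖ ^ 2 * e t * Real.exp (C * E 0 + m * T) := by ring
    _ ≤ _ := mul_le_mul_of_nonneg_right hle (Real.exp_pos _).le

/-- The supremum bound for one component, uniform in everything but the size of the data. -/
theorem norm_sq_rep_le {T m C : ℝ} (hm : 0 ≤ m) (hC : 0 ≤ C) {S : Set ℝ} {c y : ℝ}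
    (hS : ∀ f : H1, c * flux S (toL2 f) (dx f) = -‖rep f y‖ ^ 2)
    {P Q A B : ℝ → H1}
    (hP : ∀ t ∈ Icc 0 T, HasDerivWithinAt P (A t) (Icc 0 T) t)
    (hQ : ∀ t ∈ Icc 0 T, HasDerivWithinAt Q (B t) (Icc 0 T) t)
    (hcancel : ∀ t ∈ Icc 0 T, ∀ x, (conj (rep (P t) x) * rep (A t) x
      + conj (rep (shiftH (c * t) (Q t)) x) * rep (shiftH (c * t) (B t)) x).re = 0)
    (hA : ∀ t ∈ Icc 0 T, (conj (rep (P t) y) * rep (A t) y).re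
      ≤ m * ‖rep (P t) y‖ * ‖rep (shiftH (c * t) (Q t)) y‖
        + C * ‖rep (P t) y‖ ^ 2 * ‖rep (shiftH (c * t) (Q t)) y‖ ^ 2)
    {t : ℝ} (ht : t ∈ Icc 0 T) :
    ‖rep (P t) y‖ ^ 2 ≤ ((‖evalZero‖ * ‖P 0‖) ^ 2 + m * (‖P 0‖ ^ 2 + ‖Q 0‖ ^ 2))
      * Real.exp (C * (‖P 0‖ ^ 2 + ‖Q 0‖ ^ 2) + m * T) := by
  have hp : ∀ t ∈ Icc 0 T,
      HasDerivWithinAt (fun r => rep (P r) y) (rep (A t) y) (Icc 0 T) t := fun t ht =>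
    ((evalZero.comp (shiftH y).toContinuousLinearMap).restrictScalars
      ℝ).hasFDerivAt.comp_hasDerivWithinAt t (hP t ht)
  have h := norm_sq_le_of_charge hm hC hp
    (fun t ht => hasDerivWithinAt_charge_add hS (hP t ht) (hQ t ht) (hcancel t ht))
    (fun t _ => add_nonneg (charge_nonneg _ _) (charge_nonneg _ _)) hA ht
  have hE : charge S (toL2 (P 0)) + charge S (shift (c * 0) (toL2 (Q 0)))
      ≤ ‖P 0‖ ^ 2 + ‖Q 0‖ ^ 2 := by
    rw [mul_zero, shift_zero]
    exact add_le_add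
      ((charge_le _ _).trans (pow_le_pow_left₀ (norm_nonneg _) (norm_toL2_le _) 2))
      ((charge_le _ _).trans (pow_le_pow_left₀ (norm_nonneg _) (norm_toL2_le _) 2))
  refine h.trans ?_
  gcongr
  exact norm_rep_le _ _

/-! ### Global solutions of ordinary differential equations with a priori bounds -/

section ODE

variable {E : Type*} [NormedAddCommGroup E]

/-- A Lipschitz cutoff, equal to `1` on the ball of radius `R` and to `0` off that of radius
`R + 1`. -/
def cutoff (R : ℝ) (x : E) : ℝ := max (min (R + 1 - ‖x‖) 1) 0

theorem cutoff_nonneg (R : ℝ) (x : E) : 0 ≤ cutoff R x := le_max_right _ _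

theorem cutoff_le_one (R : ℝ) (x : E) : cutoff R x ≤ 1 :=
  max_le (min_le_right _ _) zero_le_one

theorem cutoff_eq_one {R : ℝ} {x : E} (h : ‖x‖ ≤ R) : cutoff R x = 1 := by
  rw [cutoff, min_eq_right (by linarith), max_eq_left zero_le_one]

theorem cutoff_eq_zero {R : ℝ} {x : E} (h : R + 1 ≤ ‖x‖) : cutoff R x = 0 :=
  max_eq_right ((min_le_left _ _).trans (by linarith))

theorem abs_cutoff_sub_le (R : ℝ) (x y : E) : |cutoff R x - cutoff R y| ≤ ‖x - y‖ := by
  refine (abs_max_sub_max_le_abs _ _ _).trans ((abs_min_sub_min_le_max _ _ _ _).trans ?_)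
  rw [sub_self, abs_zero, max_eq_left (abs_nonneg _), sub_sub_sub_cancel_left, abs_sub_comm]
  exact abs_norm_sub_norm_le x y

variable [NormedSpace ℝ E]

/-- Time-dependent vector fields that are continuous in time and, uniformly in time, bounded and
Lipschitz on bounded sets. -/
structure IsLocallyLipschitzField (G : ℝ → E → E) : Prop where
  continuous : ∀ x, Continuous fun t => G t x
  lipschitz : ∀ R : ℝ, ∃ K : ℝ, 0 ≤ K ∧ ∀ t x y, ‖x‖ ≤ R → ‖y‖ ≤ R →
    ‖G t x - G t y‖ ≤ K * ‖x - y‖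
  bounded : ∀ R : ℝ, ∃ L : ℝ, 0 ≤ L ∧ ∀ t x, ‖x‖ ≤ R → ‖G t x‖ ≤ L

namespace IsLocallyLipschitzField

variable {G : ℝ → E → E}

theorem norm_cutoff_smul_le (R : ℝ) {L : ℝ} (hL : 0 ≤ L)
    (hGL : ∀ t x, ‖x‖ ≤ R + 1 → ‖G t x‖ ≤ L) (t : ℝ) (x : E) :
    ‖cutoff R x • G t x‖ ≤ L := by
  rw [norm_smul, Real.norm_of_nonneg (cutoff_nonneg R x)]
  rcases le_total ‖x‖ (R + 1) with h | h
  · exact (mul_le_of_le_one_left (norm_nonneg _) (cutoff_le_one R x)).trans (hGL t x h)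
  · rw [cutoff_eq_zero h, zero_mul]
    exact hL

theorem norm_cutoff_smul_sub_le (R : ℝ) {K L : ℝ} (hK : 0 ≤ K)
    (hGK : ∀ t x y, ‖x‖ ≤ R + 1 → ‖y‖ ≤ R + 1 → ‖G t x - G t y‖ ≤ K * ‖x - y‖)
    (hL : 0 ≤ L) (hGL : ∀ t x, ‖x‖ ≤ R + 1 → ‖G t x‖ ≤ L) (t : ℝ) (x y : E) :
    ‖cutoff R x • G t x - cutoff R y • G t y‖ ≤ (K + L) * ‖x - y‖ := by
  -- One point may be taken in the ball, where G is bounded, so that the difference of cutoffs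
  -- multiplies G at that point. If both lie outside, both terms vanish.
  wlog hx : ‖x‖ ≤ R + 1 generalizing x y
  · by_cases hy : ‖y‖ ≤ R + 1
    · rw [norm_sub_rev, norm_sub_rev x]
      exact this y x hy
    · rw [cutoff_eq_zero (not_le.1 hx).le, cutoff_eq_zero (not_le.1 hy).le, zero_smul, zero_smul,
        sub_zero, norm_zero]
      positivity
  have h₁ : ‖(cutoff R x - cutoff R y) • G t x‖ ≤ L * ‖x - y‖ := by
    rw [norm_smul, mul_comm]
    exact mul_le_mul (hGL t x hx) (abs_cutoff_sub_le R x y) (norm_nonneg _) hL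
  have h₂ : ‖cutoff R y • (G t x - G t y)‖ ≤ K * ‖x - y‖ := by
    rcases le_total ‖y‖ (R + 1) with hy | hy
    · rw [norm_smul, Real.norm_of_nonneg (cutoff_nonneg R y)]
      exact (mul_le_of_le_one_left (norm_nonneg _) (cutoff_le_one R y)).trans (hGK t x y hx hy)
    · rw [cutoff_eq_zero hy, zero_smul, norm_zero]
      positivity
  calc ‖cutoff R x • G t x - cutoff R y • G t y‖
      = ‖(cutoff R x - cutoff R y) • G t x + cutoff R y • (G t x - G t y)‖ := by
        rw [sub_smul, smul_sub, sub_add_sub_cancel]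
    _ ≤ L * ‖x - y‖ + K * ‖x - y‖ := (norm_add_le _ _).trans (add_le_add h₁ h₂)
    _ = (K + L) * ‖x - y‖ := by ring

/-- The truncated equation can be solved on any time interval. -/
theorem exists_truncated [CompleteSpace E] (hG : IsLocallyLipschitzField G) (R : ℝ) {T : ℝ}
    (hT : 0 ≤ T) (x₀ : E) :
    ∃ X : ℝ → E, X 0 = x₀ ∧
      IsIntegralCurveOn X (fun t x => cutoff R x • G t x) (Icc 0 T) := by
  obtain ⟨K, hK, hGK⟩ := hG.lipschitz (R + 1)
  obtain ⟨L, hL, hGL⟩ := hG.bounded (R + 1)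
  -- The truncated field is bounded by L everywhere, so a ball of radius L T cannot be left before
  -- time T and no shortening of the interval is needed.
  have hPL : IsPicardLindelof (fun t x => cutoff R x • G t x) (⟨0, le_rfl, hT⟩ : Icc 0 T) x₀
      (L * T).toNNReal 0 L.toNNReal (K + L).toNNReal := by
    refine ⟨fun t _ => LipschitzOnWith.of_dist_le_mul fun x _ y _ => ?_,
      fun x _ => ((hG.continuous x).const_smul _).continuousOn, fun t _ x _ => ?_, ?_⟩
    · rw [dist_eq_norm, dist_eq_norm, Real.coe_toNNReal _ (by positivity)]
      exact norm_cutoff_smul_sub_le R hK hGK hL hGL t x y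
    · rw [Real.coe_toNNReal _ hL]
      exact norm_cutoff_smul_le R hL hGL t x
    · rw [Real.coe_toNNReal _ hL, Real.coe_toNNReal _ (by positivity)]
      simp [hT]
  exact hPL.exists_eq_forall_mem_Icc_hasDerivWithinAt₀

/-- Both curves are bounded on the compact interval, so a single Lipschitz constant covers them. -/
theorem eqOn_Icc (hG : IsLocallyLipschitzField G) {T : ℝ} {X Y : ℝ → E}
    (hX : IsIntegralCurveOn X G (Icc 0 T)) (hY : IsIntegralCurveOn Y G (Icc 0 T))
    (h0 : X 0 = Y 0) : EqOn X Y (Icc 0 T) := by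
  have hXc : ContinuousOn X (Icc 0 T) := fun t ht => (hX t ht).continuousWithinAt
  have hYc : ContinuousOn Y (Icc 0 T) := fun t ht => (hY t ht).continuousWithinAt
  obtain ⟨R₁, hR₁⟩ := isCompact_Icc.exists_bound_of_continuousOn hXc
  obtain ⟨R₂, hR₂⟩ := isCompact_Icc.exists_bound_of_continuousOn hYc
  obtain ⟨K, hK, hGK⟩ := hG.lipschitz (max R₁ R₂)
  have hright : ∀ t ∈ Ico 0 T, Icc 0 T ∈ 𝓝[Ici t] t := fun t ht =>
    mem_of_superset (Icc_mem_nhdsGE ht.2) (Icc_subset_Icc_left ht.1)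
  refine ODE_solution_unique_of_mem_Icc_right (v := G) (K := K.toNNReal)
    (s := fun _ => {x | ‖x‖ ≤ max R₁ R₂})
    (fun t _ => LipschitzOnWith.of_dist_le_mul fun x hx y hy => ?_) hXc
    (fun t ht => (hX t (Ico_subset_Icc_self ht)).mono_of_mem_nhdsWithin (hright t ht))
    (fun t ht => (hR₁ t (Ico_subset_Icc_self ht)).trans (le_max_left _ _)) hYc
    (fun t ht => (hY t (Ico_subset_Icc_self ht)).mono_of_mem_nhdsWithin (hright t ht))
    (fun t ht => (hR₂ t (Ico_subset_Icc_self ht)).trans (le_max_right _ _)) h0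
  rw [dist_eq_norm, dist_eq_norm, Real.coe_toNNReal _ hK]
  exact hGK t x y hx hy

theorem eqOn_Ici (hG : IsLocallyLipschitzField G) {X Y : ℝ → E}
    (hX : IsIntegralCurveOn X G (Ici 0)) (hY : IsIntegralCurveOn Y G (Ici 0))
    (h0 : X 0 = Y 0) : EqOn X Y (Ici 0) := fun t ht =>
  hG.eqOn_Icc (T := t) (fun r hr => (hX r hr.1).mono Icc_subset_Ici_self)
    (fun r hr => (hY r hr.1).mono Icc_subset_Ici_self) h0 ⟨ht, le_rfl⟩

/-- If the solutions of all damped equations `x' = θ(t) G(t, x)`, `0 ≤ θ ≤ 1`, obey a common bound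
on every bounded time interval, then the initial value problem is globally solvable. -/
theorem exists_global [CompleteSpace E] (hG : IsLocallyLipschitzField G) (x₀ : E)
    (hbound : ∀ T : ℝ, 0 ≤ T → ∃ B : ℝ, ∀ (θ : ℝ → ℝ) (X : ℝ → E), (∀ t, 0 ≤ θ t ∧ θ t ≤ 1) →
      X 0 = x₀ → IsIntegralCurveOn X (fun t x => θ t • G t x) (Icc 0 T) →
        ∀ t ∈ Icc 0 T, ‖X t‖ ≤ B) :
    ∃ X : ℝ → E, X 0 = x₀ ∧ IsIntegralCurveOn X G (Ici 0) := by
  have hloc : ∀ n : ℕ, ∃ X : ℝ → E, X 0 = x₀ ∧ IsIntegralCurveOn X G (Icc 0 (n : ℝ)) := fun n => by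
    obtain ⟨B, hB⟩ := hbound n n.cast_nonneg
    obtain ⟨X, hX0, hX⟩ := hG.exists_truncated B n.cast_nonneg x₀
    -- Along the solution the cutoff is a function of time alone. The bound B for damped equations
    -- then keeps the solution where the cutoff equals 1.
    have hXB := hB (fun t => cutoff B (X t)) X
      (fun t => ⟨cutoff_nonneg _ _, cutoff_le_one _ _⟩) hX0 hX
    refine ⟨X, hX0, fun t ht => ?_⟩
    have h := hX t ht
    simp only [cutoff_eq_one (hXB t ht), one_smul] at h
    exact h
  choose X hX0 hX using hloc
  have hcompat : ∀ {k n : ℕ}, k ≤ n → EqOn (X k) (X n) (Icc 0 (k : ℝ)) := fun {k n} hkn => by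
    have hsub : Icc (0 : ℝ) k ⊆ Icc 0 n := Icc_subset_Icc_right (by exact_mod_cast hkn)
    exact hG.eqOn_Icc (hX k) (fun t ht => (hX n t (hsub ht)).mono hsub) ((hX0 k).trans (hX0 n).symm)
  refine ⟨fun t => X ⌈t⌉₊ t, by simp [hX0], fun t ht => ?_⟩
  -- The extra 1 gives t < n even for integer t, so that [0, n] is a neighbourhood of t within [0,
  -- ∞).
  set n : ℕ := ⌈t⌉₊ + 1 with hn
  have htn : t < n := by
    rw [hn]
    push_cast
    linarith [Nat.le_ceil t]
  have heq : ∀ r ∈ Icc (0 : ℝ) n, X ⌈r⌉₊ r = X n r := fun r hr =>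
    hcompat (Nat.ceil_le.2 hr.2) ⟨hr.1, Nat.le_ceil r⟩
  have hmem : Icc (0 : ℝ) n ∈ 𝓝[Ici 0] t := by
    have h := inter_mem_nhdsWithin (Ici (0 : ℝ)) (Iic_mem_nhds htn)
    rwa [Ici_inter_Iic] at h
  have h₁ := (hX n t ⟨ht, htn.le⟩).mono_of_mem_nhdsWithin hmem
  have ht' := heq t ⟨ht, htn.le⟩
  simp only
  rw [ht']
  exact h₁.congr_of_eventuallyEq (by filter_upwards [hmem] with r hr using heq r hr) ht'

end IsLocallyLipschitzField

end ODE

/-! ### The Dirac system in characteristic coordinates -/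

/-- `F₁(u, v) = i (m v - N₁(u, v))` and `F₂(u, v) = i (m u - N₂(u, v))` as tame maps on
`H¹ × H¹`. -/
structure IsSource (m : ℝ) (N₁ N₂ : ℂ → ℂ → ℂ) (F₁ F₂ : H1 × H1 → H1) : Prop where
  tame₁ : Tame F₁
  tame₂ : Tame F₂
  rep₁ : ∀ X y, rep (F₁ X) y = Complex.I * (m * rep X.2 y - N₁ (rep X.1 y) (rep X.2 y))
  rep₂ : ∀ X y, rep (F₂ X) y = Complex.I * (m * rep X.1 y - N₂ (rep X.1 y) (rep X.2 y))

theorem IsAdmissible.exists_isSource {N₁ N₂ : ℂ → ℂ → ℂ} (hN : IsAdmissible N₁ N₂) (m : ℝ) :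
    ∃ F₁ F₂, IsSource m N₁ N₂ F₁ F₂ := by
  obtain ⟨M₁, hM₁, hr₁⟩ := hN.cubic₁.exists_tame Tame.fst Tame.snd
  obtain ⟨M₂, hM₂, hr₂⟩ := hN.cubic₂.exists_tame Tame.snd Tame.fst
  refine ⟨_, _, ((Tame.snd.smul m).add (hM₁.smul (-1))).smul Complex.I,
    ((Tame.fst.smul m).add (hM₂.smul (-1))).smul Complex.I, fun X y => ?_, fun X y => ?_⟩
  · simp only [rep_smul, rep_add, hr₁]
    ring
  · simp only [rep_smul, rep_add, hr₂]
    ring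

/-- The frame in which the first component is at rest. -/
def frame (t : ℝ) (X : H1 × H1) : H1 × H1 := (X.1, shiftH (2 * t) X.2)

theorem norm_frame (t : ℝ) (X : H1 × H1) : ‖frame t X‖ = ‖X‖ := by
  simp [frame, Prod.norm_def]

theorem frame_sub (t : ℝ) (X Y : H1 × H1) : frame t X - frame t Y = frame t (X - Y) := by
  simp [frame]

theorem continuous_frame : Continuous fun p : ℝ × (H1 × H1) => frame p.1 p.2 := by
  refine (continuous_fst.comp continuous_snd).prodMk ?_
  exact continuous_shiftH.comp
    ((continuous_const.mul continuous_fst).prodMk (continuous_snd.comp continuous_snd))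

/-- The system for `(u(t, · + t), v(t, · - t))`. -/
def field (F₁ F₂ : H1 × H1 → H1) (t : ℝ) (X : H1 × H1) : H1 × H1 :=
  (F₁ (frame t X), shiftH (-(2 * t)) (F₂ (frame t X)))

theorem continuous_field {F₁ F₂ : H1 × H1 → H1} (h₁ : Tame F₁) (h₂ : Tame F₂) :
    Continuous fun p : ℝ × (H1 × H1) => field F₁ F₂ p.1 p.2 := by
  refine (h₁.continuous.comp continuous_frame).prodMk ?_
  exact continuous_shiftH.comp ((continuous_const.mul continuous_fst).neg.prodMk
    (h₂.continuous.comp continuous_frame))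

/-- Changes of frame are isometries of H¹ × H¹, so the constants of the source maps hold uniformly
in time. -/
theorem isLocallyLipschitzField_field {F₁ F₂ : H1 × H1 → H1} (h₁ : Tame F₁) (h₂ : Tame F₂) :
    IsLocallyLipschitzField (field F₁ F₂) where
  continuous X := (continuous_field h₁ h₂).comp (continuous_id.prodMk continuous_const)
  lipschitz R := by
    obtain ⟨K₁, hK₁, hF₁⟩ := h₁.lipschitz R
    obtain ⟨K₂, hK₂, hF₂⟩ := h₂.lipschitz R
    refine ⟨max K₁ K₂, hK₁.trans (le_max_left _ _), fun t X Y hX hY => ?_⟩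
    rw [← norm_frame t] at hX hY
    have e₁ := hF₁ _ _ hX hY
    have e₂ := hF₂ _ _ hX hY
    rw [frame_sub, norm_frame] at e₁ e₂
    refine norm_prod_le_iff.2 ⟨e₁.trans ?_, ?_⟩
    · exact mul_le_mul_of_nonneg_right (le_max_left _ _) (norm_nonneg _)
    · simp only [field, Prod.snd_sub]
      rw [← map_sub, LinearIsometry.norm_map]
      exact e₂.trans (mul_le_mul_of_nonneg_right (le_max_right _ _) (norm_nonneg _))
  bounded R := by
    obtain ⟨L₁, hL₁, hF₁⟩ := h₁.exists_norm_le R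
    obtain ⟨L₂, hL₂, hF₂⟩ := h₂.exists_norm_le R
    refine ⟨max L₁ L₂, hL₁.trans (le_max_left _ _), fun t X hX => ?_⟩
    rw [← norm_frame t] at hX
    refine norm_prod_le_iff.2 ⟨(hF₁ _ hX).trans (le_max_left _ _), ?_⟩
    simp only [field, LinearIsometry.norm_map]
    exact (hF₂ _ hX).trans (le_max_right _ _)

theorem rep_real_smul (θ : ℝ) (f : H1) (y : ℝ) : rep (θ • f) y = θ * rep f y :=
  rep_smul (θ : ℂ) f y

/-- The mass terms add up to i times the real number 2m Re(ūv), and (A2) removes the rest. The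
identity is pointwise and homogeneous in θ, hence unaffected by damping. -/
theorem IsAdmissible.re_source_eq_zero {N₁ N₂ : ℂ → ℂ → ℂ} (hN : IsAdmissible N₁ N₂)
    (m θ : ℝ) (u v : ℂ) :
    (conj u * (θ * (Complex.I * (m * v - N₁ u v)))
      + conj v * (θ * (Complex.I * (m * u - N₂ u v)))).re = 0 := by
  have h := hN.charge u v
  have h₁ : conj u * (θ * (Complex.I * (m * v - N₁ u v)))
      + conj v * (θ * (Complex.I * (m * u - N₂ u v)))
      = (θ * m : ℝ) * (Complex.I * (conj u * v + conj v * u))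
        - (θ : ℝ) * (Complex.I * conj u * N₁ u v + Complex.I * conj v * N₂ u v) := by
    push_cast
    ring
  rw [h₁, Complex.sub_re, Complex.re_ofReal_mul, Complex.re_ofReal_mul, h]
  simp only [Complex.mul_re, Complex.mul_im, Complex.add_re, Complex.add_im, Complex.I_re,
    Complex.I_im, Complex.conj_re, Complex.conj_im]
  ring

theorem re_conj_mul_source_le {m θ C : ℝ} (hm : 0 ≤ m) (h0 : 0 ≤ θ) (h1 : θ ≤ 1)
    {p w n : ℂ} (hn : ‖n‖ ≤ C * ‖p‖ * ‖w‖ ^ 2) :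
    (conj p * (θ * (Complex.I * (m * w - n)))).re
      ≤ m * ‖p‖ * ‖w‖ + C * ‖p‖ ^ 2 * ‖w‖ ^ 2 := by
  have h₁ : ‖(m : ℂ) * w - n‖ ≤ m * ‖w‖ + C * ‖p‖ * ‖w‖ ^ 2 := by
    refine (norm_sub_le _ _).trans (add_le_add (le_of_eq ?_) hn)
    rw [norm_mul, Complex.norm_real, Real.norm_of_nonneg hm]
  calc _ ≤ ‖conj p * (θ * (Complex.I * (m * w - n)))‖ := Complex.re_le_norm _
    _ = θ * (‖p‖ * ‖(m : ℂ) * w - n‖) := by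
      simp only [norm_mul, RCLike.norm_conj, Complex.norm_I, Complex.norm_real,
        Real.norm_of_nonneg h0]
      ring
    _ ≤ ‖p‖ * ‖(m : ℂ) * w - n‖ := mul_le_of_le_one_left (by positivity) h1
    _ ≤ ‖p‖ * (m * ‖w‖ + C * ‖p‖ * ‖w‖ ^ 2) := mul_le_mul_of_nonneg_left h₁ (norm_nonneg _)
    _ = _ := by ring

/-- The a priori supremum bound. -/
theorem exists_forall_norm_rep_le {m : ℝ} (hm : 0 ≤ m) {N₁ N₂ : ℂ → ℂ → ℂ}
    (hN : IsAdmissible N₁ N₂) {F₁ F₂ : H1 × H1 → H1} (hF : IsSource m N₁ N₂ F₁ F₂)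
    (X₀ : H1 × H1) (T : ℝ) :
    ∃ M : ℝ, ∀ (θ : ℝ → ℝ) (X : ℝ → H1 × H1), (∀ t, 0 ≤ θ t ∧ θ t ≤ 1) → X 0 = X₀ →
      IsIntegralCurveOn X (fun t x => θ t • field F₁ F₂ t x) (Icc 0 T) →
        ∀ t ∈ Icc 0 T, ∀ y, ‖rep (X t).1 y‖ ≤ M ∧ ‖rep (X t).2 y‖ ≤ M := by
  obtain ⟨C₁, hC₁, hb₁⟩ := hN.cubic₁.exists_norm_le
  obtain ⟨C₂, hC₂, hb₂⟩ := hN.cubic₂.exists_norm_le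
  refine ⟨max (√(((‖evalZero‖ * ‖X₀.1‖) ^ 2 + m * (‖X₀.1‖ ^ 2 + ‖X₀.2‖ ^ 2))
      * Real.exp (C₁ * (‖X₀.1‖ ^ 2 + ‖X₀.2‖ ^ 2) + m * T)))
    (√(((‖evalZero‖ * ‖X₀.2‖) ^ 2 + m * (‖X₀.2‖ ^ 2 + ‖X₀.1‖ ^ 2))
      * Real.exp (C₂ * (‖X₀.2‖ ^ 2 + ‖X₀.1‖ ^ 2) + m * T))), ?_⟩
  rintro θ X hθ rfl hX t ht y
  have hP : ∀ t ∈ Icc 0 T, HasDerivWithinAt (fun r => (X r).1)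
      (θ t • F₁ (frame t (X t))) (Icc 0 T) t := fun t ht =>
    (ContinuousLinearMap.fst ℝ H1 H1).hasFDerivAt.comp_hasDerivWithinAt t (hX t ht)
  have hQ : ∀ t ∈ Icc 0 T, HasDerivWithinAt (fun r => (X r).2)
      (θ t • shiftH (-(2 * t)) (F₂ (frame t (X t)))) (Icc 0 T) t := fun t ht =>
    (ContinuousLinearMap.snd ℝ H1 H1).hasFDerivAt.comp_hasDerivWithinAt t (hX t ht)
  constructor
  -- With the first component at rest, the second moves with relative velocity -2 and leaves (y, ∞)
  -- through y.
  · refine (Real.le_sqrt_of_sq_le (norm_sq_rep_le hm hC₁ (S := Ioi y) (c := 2)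
      (fun f => flux_Ioi_dx f y) hP hQ (fun t _ x => ?_) (fun t _ => ?_) ht)).trans
      (le_max_left _ _)
    · simp only [rep_shiftH, rep_real_smul, hF.rep₁, hF.rep₂, frame, add_neg_cancel_right]
      exact hN.re_source_eq_zero m (θ t) _ _
    · simp only [rep_shiftH, rep_real_smul, hF.rep₁, frame]
      exact re_conj_mul_source_le hm (hθ t).1 (hθ t).2 (hb₁ _ _)
  -- The mirror image: with the second component at rest, the first leaves (-∞, y] through y.
  · refine (Real.le_sqrt_of_sq_le (norm_sq_rep_le hm hC₂ (S := Iic y) (c := -2)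
      (fun f => ?_) hQ hP (fun t _ x => ?_) (fun t _ => ?_) ht)).trans (le_max_right _ _)
    · rw [neg_mul, flux_Iic_dx]
    · simp only [rep_shiftH, rep_real_smul, hF.rep₁, hF.rep₂, frame, neg_mul,
        neg_add_cancel_right]
      rw [add_comm]
      exact hN.re_source_eq_zero m (θ t) _ _
    · simp only [rep_shiftH, rep_real_smul, hF.rep₂, frame, neg_mul, neg_add_cancel_right]
      exact re_conj_mul_source_le hm (hθ t).1 (hθ t).2 (hb₂ _ _)

/-- The a priori bound in `H¹`. -/
theorem exists_forall_norm_le {m : ℝ} (hm : 0 ≤ m) {N₁ N₂ : ℂ → ℂ → ℂ}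
    (hN : IsAdmissible N₁ N₂) {F₁ F₂ : H1 × H1 → H1} (hF : IsSource m N₁ N₂ F₁ F₂)
    (X₀ : H1 × H1) (T : ℝ) :
    ∃ B : ℝ, ∀ (θ : ℝ → ℝ) (X : ℝ → H1 × H1), (∀ t, 0 ≤ θ t ∧ θ t ≤ 1) → X 0 = X₀ →
      IsIntegralCurveOn X (fun t x => θ t • field F₁ F₂ t x) (Icc 0 T) →
        ∀ t ∈ Icc 0 T, ‖X t‖ ≤ B := by
  obtain ⟨M, hM⟩ := exists_forall_norm_rep_le hm hN hF X₀ T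
  obtain ⟨K₁, hK₁, hg₁⟩ := hF.tame₁.growth M
  obtain ⟨K₂, hK₂, hg₂⟩ := hF.tame₂.growth M
  refine ⟨‖X₀‖ * Real.exp (max K₁ K₂ * T), fun θ X hθ h0 hX t ht => ?_⟩
  have hright : ∀ t ∈ Ico 0 T, Icc 0 T ∈ 𝓝[Ici t] t := fun t ht =>
    mem_of_superset (Icc_mem_nhdsGE ht.2) (Icc_subset_Icc_left ht.1)
  -- The supremum bound turns the cubic field into one of linear growth, uniformly in θ, as Gronwall
  -- requires.
  have hbd : ∀ t ∈ Ico 0 T, ‖θ t • field F₁ F₂ t (X t)‖ ≤ max K₁ K₂ * ‖X t‖ + 0 := fun t ht => by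
    have hsup := hM θ X hθ h0 hX t (Ico_subset_Icc_self ht)
    have hs₂ : ∀ y, ‖rep (frame t (X t)).2 y‖ ≤ M := fun y => by
      simp only [frame, rep_shiftH]
      exact (hsup _).2
    have e₁ := (hg₁ (frame t (X t)) (fun y => (hsup y).1) hs₂).2
    have e₂ := (hg₂ (frame t (X t)) (fun y => (hsup y).1) hs₂).2
    rw [norm_frame] at e₁ e₂
    rw [add_zero, norm_smul, Real.norm_of_nonneg (hθ t).1]
    refine (mul_le_of_le_one_left (norm_nonneg _) (hθ t).2).trans (norm_prod_le_iff.2 ⟨?_, ?_⟩)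
    · exact e₁.trans (mul_le_mul_of_nonneg_right (le_max_left _ _) (norm_nonneg _))
    · simp only [field, LinearIsometry.norm_map]
      exact e₂.trans (mul_le_mul_of_nonneg_right (le_max_right _ _) (norm_nonneg _))
  have h := norm_le_gronwallBound_of_norm_deriv_right_le
    (fun t ht => (hX t ht).continuousWithinAt)
    (fun t ht => (hX t (Ico_subset_Icc_self ht)).mono_of_mem_nhdsWithin (hright t ht))
    le_rfl hbd t ht
  rw [gronwallBound_ε0, h0, sub_zero] at h
  refine h.trans ?_
  gcongr
  exact ht.2

/-! ### Equivalence of the two formulations -/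

/-- A curve in `H¹` whose `L²` derivative is continuous in `H¹` is differentiable in `H¹`. -/
theorem hasDerivWithinAt_of_toL2 {w g : ℝ → H1} (hg : ContinuousOn g (Ici 0))
    (hw : ∀ t ∈ Ici (0 : ℝ), HasDerivWithinAt (fun r => toL2 (w r)) (toL2 (g t)) (Ici 0) t)
    {t : ℝ} (ht : t ∈ Ici (0 : ℝ)) : HasDerivWithinAt w (g t) (Ici 0) t := by
  have hgc : Continuous fun r => g (max r 0) :=
    hg.comp_continuous (continuous_id.max continuous_const) fun r => le_max_right r 0
  -- The H¹ primitive of g has the same L² derivative and initial value as w, hence equals it.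
  -- Replacing s by max s 0 extends g continuously to the whole line.
  set z : ℝ → H1 := fun r => w 0 + ∫ s in (0 : ℝ)..r, g (max s 0) with hz
  have hzd : ∀ r ∈ Ici (0 : ℝ), HasDerivWithinAt z (g r) (Ici 0) r := fun r hr => by
    have h := (intervalIntegral.integral_hasDerivAt_right (hgc.intervalIntegrable 0 r)
      (hgc.stronglyMeasurableAtFilter _ _) hgc.continuousAt).const_add (w 0)
    rw [max_eq_left hr] at h
    exact h.hasDerivWithinAt
  have hd : ∀ r ∈ Ici (0 : ℝ), HasDerivWithinAt (fun r => toL2 (z r) - toL2 (w r)) 0 (Ici 0) r :=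
    fun r hr => by
      have h : HasDerivWithinAt (fun r => toL2 (z r)) (toL2 (g r)) (Ici 0) r :=
        (toL2L.restrictScalars ℝ).hasFDerivAt.comp_hasDerivWithinAt r (hzd r hr)
      simpa using h.fun_sub (hw r hr)
  have heq : ∀ r ∈ Ici (0 : ℝ), w r = z r := fun r hr => by
    have h := constant_of_has_deriv_right_zero (a := 0) (b := r)
      (fun s hs => ((hd s hs.1).continuousWithinAt).mono Icc_subset_Ici_self)
      (fun s hs => (hd s hs.1).mono (Ici_subset_Ici.2 hs.1)) r ⟨hr, le_rfl⟩
    have hz0 : z 0 = w 0 := by simp [hz]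
    rw [hz0, sub_self, sub_eq_zero] at h
    exact (toL2_injective h).symm
  exact (hzd t ht).congr heq (heq t ht)

variable {m : ℝ} {N₁ N₂ : ℂ → ℂ → ℂ} {F₁ F₂ : H1 × H1 → H1}

/-- The source acts pointwise on representatives, so it commutes with simultaneous translation of
both components. -/
theorem IsSource.shiftH₁ (hF : IsSource m N₁ N₂ F₁ F₂) (a : ℝ) (f g : H1) :
    F₁ (shiftH a f, shiftH a g) = shiftH a (F₁ (f, g)) :=
  rep_injective (funext fun y => by simp only [hF.rep₁, rep_shiftH])

theorem IsSource.shiftH₂ (hF : IsSource m N₁ N₂ F₁ F₂) (a : ℝ) (f g : H1) :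
    F₂ (shiftH a f, shiftH a g) = shiftH a (F₂ (f, g)) :=
  rep_injective (funext fun y => by simp only [hF.rep₂, rep_shiftH])

theorem IsSource.eq_of_ae₁ (hF : IsSource m N₁ N₂ F₁ F₂) {u v : H1} {d : L2} :
    (∀ᵐ x : ℝ, Complex.I * (d x + dx u x)
      = -(m : ℂ) * toL2 v x + N₁ (toL2 u x) (toL2 v x)) ↔ d + dx u = toL2 (F₁ (u, v)) := by
  rw [Lp.ext_iff]
  constructor <;> intro h <;>
  filter_upwards [h, toL2_ae_eq_rep u, toL2_ae_eq_rep v, toL2_ae_eq_rep (F₁ (u, v)),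
    Lp.coeFn_add d (dx u)] with x h h₁ h₂ h₃ h₄
  · rw [h₄, Pi.add_apply, h₃, hF.rep₁]
    rw [h₁, h₂] at h
    simp only
    linear_combination (-Complex.I) * h + (d x + dx u x) * Complex.I_sq
  · rw [h₄, Pi.add_apply, h₃, hF.rep₁] at h
    rw [h₁, h₂, h]
    simp only
    linear_combination (m * rep v x - N₁ (rep u x) (rep v x)) * Complex.I_sq

theorem IsSource.eq_of_ae₂ (hF : IsSource m N₁ N₂ F₁ F₂) {u v : H1} {d : L2} :
    (∀ᵐ x : ℝ, Complex.I * (d x - dx v x)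
      = -(m : ℂ) * toL2 u x + N₂ (toL2 u x) (toL2 v x)) ↔ d - dx v = toL2 (F₂ (u, v)) := by
  rw [Lp.ext_iff]
  constructor <;> intro h <;>
  filter_upwards [h, toL2_ae_eq_rep u, toL2_ae_eq_rep v, toL2_ae_eq_rep (F₂ (u, v)),
    Lp.coeFn_sub d (dx v)] with x h h₁ h₂ h₃ h₄
  · rw [h₄, Pi.sub_apply, h₃, hF.rep₂]
    rw [h₁, h₂] at h
    simp only
    linear_combination (-Complex.I) * h + (d x - dx v x) * Complex.I_sq
  · rw [h₄, Pi.sub_apply, h₃, hF.rep₂] at h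
    rw [h₁, h₂, h]
    simp only
    linear_combination (m * rep u x - N₂ (rep u x) (rep v x)) * Complex.I_sq

theorem continuousOn_shiftH {f : ℝ → H1} {s : Set ℝ} (hf : ContinuousOn f s) (c : ℝ) :
    ContinuousOn (fun t => shiftH (c * t) (f t)) s := by
  have h : ContinuousOn (fun t => (c * t, f t)) s :=
    (by fun_prop : Continuous fun t : ℝ => c * t).continuousOn.prodMk hf
  have h' := continuous_shiftH.comp_continuousOn h
  exact h'

/-- In characteristic coordinates, a solution of the Dirac system is an integral curve. -/
theorem IsGlobalSolution.isIntegralCurveOn (hF : IsSource m N₁ N₂ F₁ F₂) {u₀ v₀ : H1}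
    {u v : ℝ → H1} (h : IsGlobalSolution m N₁ N₂ u₀ v₀ u v) :
    IsIntegralCurveOn (fun t => (shiftH (1 * t) (u t), shiftH (-1 * t) (v t)))
      (field F₁ F₂) (Ici 0) := by
  set X : ℝ → H1 × H1 := fun t => (shiftH (1 * t) (u t), shiftH (-1 * t) (v t)) with hXdef
  have hXc : ContinuousOn X (Ici 0) :=
    (continuousOn_shiftH h.continuousOn_u 1).prodMk (continuousOn_shiftH h.continuousOn_v (-1))
  have hfr : ∀ t, frame t (X t) = (shiftH (1 * t) (u t), shiftH (1 * t) (v t)) := fun t => by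
    simp only [frame, hXdef, shiftH_shiftH]
    rw [show 2 * t + -1 * t = 1 * t by ring]
  have hfc : ContinuousOn (fun t => field F₁ F₂ t (X t)) (Ici 0) :=
    (continuous_field hF.tame₁ hF.tame₂).comp_continuousOn (continuousOn_id.prodMk hXc)
  have hud : ∀ t ∈ Ici (0 : ℝ), HasDerivWithinAt (fun r => toL2 (u r))
      (derivWithin (fun r => toL2 (u r)) (Ici 0) t) (Ici 0) t := fun t ht =>
    (h.contDiffOn_u.differentiableOn one_ne_zero t ht).hasDerivWithinAt
  have hvd : ∀ t ∈ Ici (0 : ℝ), HasDerivWithinAt (fun r => toL2 (v r))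
      (derivWithin (fun r => toL2 (v r)) (Ici 0) t) (Ici 0) t := fun t ht =>
    (h.contDiffOn_v.differentiableOn one_ne_zero t ht).hasDerivWithinAt
  intro t ht
  -- The time derivative exists a priori only in L². In the moving frame the ∂ₓ term cancels and the
  -- remaining source is continuous in H¹, which upgrades differentiability to H¹.
  refine HasDerivWithinAt.prodMk
    (hasDerivWithinAt_of_toL2 (g := fun t => (field F₁ F₂ t (X t)).1)
      (continuous_fst.comp_continuousOn hfc) (fun t ht => ?_) ht)
    (hasDerivWithinAt_of_toL2 (g := fun t => (field F₁ F₂ t (X t)).2)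
      (continuous_snd.comp_continuousOn hfc) (fun t ht => ?_) ht)
  · refine (hasDerivWithinAt_shift 1 (hud t ht)).congr_deriv ?_
    rw [one_smul, hF.eq_of_ae₁.1 (h.eq_u t ht), ← toL2_shiftH]
    simp only [field]
    rw [hfr, hF.shiftH₁]
  · refine (hasDerivWithinAt_shift (-1) (hvd t ht)).congr_deriv ?_
    rw [neg_one_smul, ← sub_eq_add_neg, hF.eq_of_ae₂.1 (h.eq_v t ht), ← toL2_shiftH]
    simp only [field]
    rw [hfr, hF.shiftH₂, shiftH_shiftH, show -(2 * t) + 1 * t = -1 * t by ring]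

/-- An integral curve in characteristic coordinates is a solution of the Dirac system. -/
theorem isGlobalSolution_of_isIntegralCurveOn (hF : IsSource m N₁ N₂ F₁ F₂)
    {X : ℝ → H1 × H1} (hX : IsIntegralCurveOn X (field F₁ F₂) (Ici 0)) :
    IsGlobalSolution m N₁ N₂ (X 0).1 (X 0).2
      (fun t => shiftH (-1 * t) (X t).1) (fun t => shiftH (1 * t) (X t).2) := by
  set u : ℝ → H1 := fun t => shiftH (-1 * t) (X t).1 with hu
  set v : ℝ → H1 := fun t => shiftH (1 * t) (X t).2 with hv
  have hXc : ContinuousOn X (Ici 0) := fun t ht => (hX t ht).continuousWithinAt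
  have huc : ContinuousOn u (Ici 0) :=
    continuousOn_shiftH (continuous_fst.comp_continuousOn hXc) (-1)
  have hvc : ContinuousOn v (Ici 0) :=
    continuousOn_shiftH (continuous_snd.comp_continuousOn hXc) 1
  have hfr : ∀ t, frame t (X t) = (shiftH (1 * t) (u t), shiftH (1 * t) (v t)) := fun t => by
    simp only [frame, hu, hv, shiftH_shiftH]
    rw [show 1 * t + -1 * t = 0 by ring, show 1 * t + 1 * t = 2 * t by ring, shiftH_zero]
  -- Returning to the fixed frame brings back ∂ₓu, which lies only in L²; hence u is C¹ with values
  -- in L².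
  have hud : ∀ t ∈ Ici (0 : ℝ), HasDerivWithinAt (fun r => toL2 (u r))
      (toL2 (F₁ (u t, v t)) - dx (u t)) (Ici 0) t := fun t ht => by
    have h₁ : HasDerivWithinAt (fun r => toL2 (X r).1) (toL2 (F₁ (frame t (X t)))) (Ici 0) t :=
      ((toL2L.restrictScalars ℝ).comp
        (ContinuousLinearMap.fst ℝ H1 H1)).hasFDerivAt.comp_hasDerivWithinAt t (hX t ht)
    refine (hasDerivWithinAt_shift (q := fun r => (X r).1) (-1) h₁).congr_deriv ?_
    rw [neg_one_smul, ← sub_eq_add_neg, map_sub, ← toL2_shiftH, ← dx_shiftH, hfr, hF.shiftH₁,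
      shiftH_shiftH]
    simp [hu]
  have hvd : ∀ t ∈ Ici (0 : ℝ), HasDerivWithinAt (fun r => toL2 (v r))
      (toL2 (F₂ (u t, v t)) + dx (v t)) (Ici 0) t := fun t ht => by
    have h₁ : HasDerivWithinAt (fun r => toL2 (X r).2)
        (toL2 (shiftH (-(2 * t)) (F₂ (frame t (X t))))) (Ici 0) t :=
      ((toL2L.restrictScalars ℝ).comp
        (ContinuousLinearMap.snd ℝ H1 H1)).hasFDerivAt.comp_hasDerivWithinAt t (hX t ht)
    refine (hasDerivWithinAt_shift (q := fun r => (X r).2) 1 h₁).congr_deriv ?_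
    rw [one_smul, map_add, ← toL2_shiftH, ← dx_shiftH, hfr, hF.shiftH₂, shiftH_shiftH,
      shiftH_shiftH, show 1 * t + -(2 * t) + 1 * t = 0 by ring, shiftH_zero]
  have hpc : ContinuousOn (fun t => (u t, v t)) (Ici 0) := huc.prodMk hvc
  have hunique := uniqueDiffOn_Ici (0 : ℝ)
  refine ⟨huc, hvc, ?_, ?_, fun t ht => ?_, fun t ht => ?_, by simp [hu], by simp [hv]⟩
  · refine (contDiffOn_one_iff_derivWithin hunique).2
      ⟨fun t ht => (hud t ht).differentiableWithinAt, ?_⟩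
    refine ContinuousOn.congr ?_ fun t ht => (hud t ht).derivWithin (hunique t ht)
    exact (toL2L.continuous.comp_continuousOn (hF.tame₁.continuous.comp_continuousOn hpc)).sub
      (dxL.continuous.comp_continuousOn huc)
  · refine (contDiffOn_one_iff_derivWithin hunique).2
      ⟨fun t ht => (hvd t ht).differentiableWithinAt, ?_⟩
    refine ContinuousOn.congr ?_ fun t ht => (hvd t ht).derivWithin (hunique t ht)
    exact (toL2L.continuous.comp_continuousOn (hF.tame₂.continuous.comp_continuousOn hpc)).add
      (dxL.continuous.comp_continuousOn hvc)
  · refine hF.eq_of_ae₁.2 ?_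
    rw [(hud t ht).derivWithin (hunique t ht), sub_add_cancel]
  · refine hF.eq_of_ae₂.2 ?_
    rw [(hvd t ht).derivWithin (hunique t ht), add_sub_cancel_right]

/-- Global well-posedness of the Dirac system in `H¹`, for data of any size. -/
theorem IsAdmissible.exists_unique_global (hN : IsAdmissible N₁ N₂) (hm : 0 ≤ m) (u₀ v₀ : H1) :
    ∃ u v : ℝ → H1, IsGlobalSolution m N₁ N₂ u₀ v₀ u v ∧
      ∀ u' v' : ℝ → H1, IsGlobalSolution m N₁ N₂ u₀ v₀ u' v' →
        EqOn u' u (Ici 0) ∧ EqOn v' v (Ici 0) := by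
  obtain ⟨F₁, F₂, hF⟩ := hN.exists_isSource m
  have hG := isLocallyLipschitzField_field hF.tame₁ hF.tame₂
  obtain ⟨X, hX0, hX⟩ := hG.exists_global (u₀, v₀)
    fun T _ => exists_forall_norm_le hm hN hF (u₀, v₀) T
  have hsol := isGlobalSolution_of_isIntegralCurveOn hF hX
  rw [hX0] at hsol
  refine ⟨_, _, hsol, fun u' v' h' => ?_⟩
  have heq := hG.eqOn_Ici (h'.isIntegralCurveOn hF) hX (by
    simp [h'.initial_u, h'.initial_v, hX0])
  refine ⟨fun t ht => ?_, fun t ht => ?_⟩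
  · have h := congrArg Prod.fst (heq ht)
    simp only at h
    simp only
    rw [← h, shiftH_shiftH]
    simp
  · have h := congrArg Prod.snd (heq ht)
    simp only at h
    simp only
    rw [← h, shiftH_shiftH]
    simp

/-! ### The Thirring and Gross–Neveu nonlinearities -/

theorem isAdmissible_thirring (α : ℝ) :
    IsAdmissible (fun u v => α * u * (‖v‖ : ℂ) ^ 2) (fun u v => α * v * (‖u‖ : ℂ) ^ 2) where
  cubic₁ := ⟨![α, 0, 0], ![0, 0, 0], fun p q => by simp; ring⟩
  cubic₂ := ⟨![α, 0, 0], ![0, 0, 0], fun p q => by simp; ring⟩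
  charge u v := by
    simp only [← Complex.mul_conj', Complex.mul_re, Complex.mul_im, Complex.add_re, Complex.I_re,
      Complex.I_im, Complex.conj_re, Complex.conj_im, Complex.ofReal_re, Complex.ofReal_im]
    ring

theorem isAdmissible_grossNeveu (α : ℝ) :
    IsAdmissible (fun u v => 2 * α * v * (conj u * v + u * conj v))
      (fun u v => 2 * α * u * (conj u * v + u * conj v)) where
  cubic₁ := ⟨![2 * α, 0, 0], ![0, 2 * α, 0], fun p q => by
    simp [← Complex.mul_conj']; ring⟩
  cubic₂ := ⟨![2 * α, 0, 0], ![0, 2 * α, 0], fun p q => by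
    simp [← Complex.mul_conj']; ring⟩
  charge u v := by
    simp only [Complex.mul_re, Complex.mul_im, Complex.add_re, Complex.add_im, Complex.I_re,
      Complex.I_im, Complex.conj_re, Complex.conj_im, Complex.ofReal_re, Complex.ofReal_im,
      Complex.re_ofNat, Complex.im_ofNat]
    ring

end Dirac

end

/-- The first two claims are the membership of the massive Thirring and of the massive Gross–Neveu
nonlinearities in the admissible class; the third is global existence and uniqueness. -/
theorem theorem1p1 :
    (∀ α : ℝ, Dirac.IsAdmissible
      (fun u v => α * u * (‖v‖ : ℂ) ^ 2) (fun u v => α * v * (‖u‖ : ℂ) ^ 2)) ∧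
    (∀ α : ℝ, Dirac.IsAdmissible
      (fun u v => 2 * α * v * (conj u * v + u * conj v))
      (fun u v => 2 * α * u * (conj u * v + u * conj v))) ∧
    ∀ N₁ N₂ : ℂ → ℂ → ℂ, Dirac.IsAdmissible N₁ N₂ →
      ∃ C₀ : ℝ, 0 < C₀ ∧
        ∀ m : ℝ, 0 ≤ m → ∀ u₀ v₀ : Dirac.H1,
          ‖Dirac.toL2 u₀‖ ^ 2 + ‖Dirac.toL2 v₀‖ ^ 2 ≤ C₀ →
            ∃ u v : ℝ → Dirac.H1, Dirac.IsGlobalSolution m N₁ N₂ u₀ v₀ u v ∧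
              ∀ u' v' : ℝ → Dirac.H1, Dirac.IsGlobalSolution m N₁ N₂ u₀ v₀ u' v' →
                Set.EqOn u' u (Set.Ici 0) ∧ Set.EqOn v' v (Set.Ici 0) := by
  -- The a priori bounds are finite for every value of the charge, so any positive number can serve
  -- as C₀.
  refine ⟨Dirac.isAdmissible_thirring, Dirac.isAdmissible_grossNeveu, fun N₁ N₂ hN =>
    ⟨1, one_pos, fun m hm u₀ v₀ _ => hN.exists_unique_global hm u₀ v₀⟩⟩
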